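/- For a complex Banach space $X$, let $\mathcal B(X)$ be the algebra of bounded linear operators on $X$. A standard operator algebra on $X$ is a subalgebra of $\mathcal B(X)$ (not necessarily closed or unital) containing all finite rank operators. For $T\in\mathcal B(X)$ with spectrum $\sigma(T)$ and spectral radius $r(T)$, let $\sigma_\pi(T)=\{z\in\sigma(T):|z|=r(T)\}$ be its peripheral spectrum. Let $k\ge 2$, and let $(i_1,\dots,i_m)$ be a finite sequence with $\{i_1,\dots,i_m\}=\{1,\dots,k\}$ such that, for some position $p$, $i_q\ne i_p$ for all $q\ne p$. The associated generalized product, of width $m$, is $T_1*\cdots*T_k=T_{i_1}T_{i_2}\cdots T_{i_m}$. It is called quasi-semi Jordan if $$(i_{p+1},\dots,i_m,i_1,\dots,i_{p-1})=(i_{p-1},\dots,i_1,i_m,\dots,i_{p+1}).$$ Let $\mathcal A_1,\mathcal A_2$ be standard operator algebras on complex Banach spaces $X_1,X_2$, and let $\Phi:\mathcal A_1\to\mathcal A_2$ be a map (not assumed linear or continuous) whose range contains all operators in $\mathcal B(X_2)$ of rank at most two. Then $$\sigma_\pi(\Phi(A_1)*\cdots*\Phi(A_k))=\sigma_\pi(A_1*\cdots*A_k)\quad\text{for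 all }A_1,\dots,A_k\in\mathcal A_1\qquad(\ast)$$ if and only if one of the following holds: (1) there exist $\lambda\in\mathbb C$ with $\lambda^m=1$ and an invertible operator $T\in\mathcal B(X_1,X_2)$ such that $\Phi(A)=\lambda TAT^{-1}$ for all $A\in\mathcal A_1$; (2) there exist $\lambda\in\mathbb C$ with $\lambda^m=1$ and an invertible operator $T\in\mathcal B(X_1^*,X_2)$ such that $\Phi(A)=\lambda TA^*T^{-1}$ for all $A\in\mathcal A_1$, where $A^*$ is the Banach space adjoint of $A$; moreover $X_1$ and $X_2$ are reflexive and the generalized product is quasi-semi Jordan. Furthermore, whenever $\Phi(A)=\lambda TA^*T^{-1}$ for all $A\in\mathcal A_1$ with $\lambda$ and $T$ as in (2), the spaces $X_1$ and $X_2$ are reflexive; and if in addition $(\ast)$ holds and $\dim X_1\ge 2$, then the generalized product is quasi-semi Jordan. -/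

import Mathlib

open scoped ENNReal

noncomputable section

/-- A standard operator algebra on `X`: a (not necessarily unital, not necessarily closed)
subalgebra of the bounded operators that contains every bounded operator of finite rank. -/
def IsStandardOperatorAlgebra {X : Type*} [NormedAddCommGroup X] [NormedSpace ℂ X]
    (𝒜 : NonUnitalSubalgebra ℂ (X →L[ℂ] X)) : Prop :=
  ∀ F : X →L[ℂ] X, FiniteDimensional ℂ (LinearMap.range (F : X →ₗ[ℂ] X)) → F ∈ 𝒜

/-- The peripheral spectrum: the points of the spectrum (in the algebra of all bounded operators)
whose modulus is the spectral radius. -/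
def peripheralSpectrum {X : Type*} [NormedAddCommGroup X] [NormedSpace ℂ X]
    (T : X →L[ℂ] X) : Set ℂ :=
  {z | z ∈ spectrum ℂ T ∧ (‖z‖₊ : ℝ≥0∞) = spectralRadius ℂ T}

/-- `i` is the index sequence of a generalized product of `k` operators with width `m`, and `p` is
a position whose index occurs nowhere else in the sequence. -/
structure IsGeneralizedProductIndex {k m : ℕ} (i : Fin m → Fin k) (p : Fin m) : Prop where
  surjective : Function.Surjective i
  unique : ∀ q : Fin m, q ≠ p → i q ≠ i p

/-- The generalized product `T_{i 0} T_{i 1} ⋯ T_{i (m-1)}`. -/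
def generalizedProduct {X : Type*} [NormedAddCommGroup X] [NormedSpace ℂ X] {k m : ℕ}
    (i : Fin m → Fin k) (T : Fin k → (X →L[ℂ] X)) : X →L[ℂ] X :=
  (List.ofFn fun j => T (i j)).prod

/-- The generalized product with index sequence `i` is quasi-semi Jordan with respect to the
position `p`: the sequence read cyclically from just after `p` to just before `p` is equal to
its reversal. -/
def IsQuasiSemiJordan {k m : ℕ} (i : Fin m → Fin k) (p : Fin m) : Prop :=
  (List.ofFn i).drop ((p : ℕ) + 1) ++ (List.ofFn i).take (p : ℕ) =
    ((List.ofFn i).take (p : ℕ)).reverse ++ ((List.ofFn i).drop ((p : ℕ) + 1)).reverse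

/-- The Banach space adjoint `A* : X* → X*`, `f ↦ f ∘ A`. -/
def banachAdjoint {X : Type*} [NormedAddCommGroup X] [NormedSpace ℂ X]
    (A : X →L[ℂ] X) : StrongDual ℂ X →L[ℂ] StrongDual ℂ X :=
  ContinuousLinearMap.precomp ℂ A

/-- Reflexivity: the canonical embedding into the bidual is onto. -/
def IsReflexiveSpace (X : Type*) [NormedAddCommGroup X] [NormedSpace ℂ X] : Prop :=
  Function.Surjective (NormedSpace.inclusionInDoubleDual ℂ X)

section Maps

variable {X₁ X₂ : Type*} [NormedAddCommGroup X₁] [NormedSpace ℂ X₁]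
  [NormedAddCommGroup X₂] [NormedSpace ℂ X₂]
  {𝒜₁ : NonUnitalSubalgebra ℂ (X₁ →L[ℂ] X₁)} {𝒜₂ : NonUnitalSubalgebra ℂ (X₂ →L[ℂ] X₂)}

/-- `Φ` preserves the peripheral spectrum of the generalized product with index sequence `i`. -/
def PreservesPeripheralSpectrum {k m : ℕ} (i : Fin m → Fin k) (Φ : 𝒜₁ → 𝒜₂) : Prop :=
  ∀ A : Fin k → 𝒜₁,
    peripheralSpectrum (generalizedProduct i fun j => (Φ (A j) : X₂ →L[ℂ] X₂)) =
      peripheralSpectrum (generalizedProduct i fun j => (A j : X₁ →L[ℂ] X₁))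

/-- `Φ(A) = l T A T⁻¹` with `l ^ m = 1` and `T : X₁ → X₂` bounded and invertible. -/
def IsIsomorphismForm (m : ℕ) (Φ : 𝒜₁ → 𝒜₂) : Prop :=
  ∃ (l : ℂ) (T : X₁ ≃L[ℂ] X₂), l ^ m = 1 ∧ ∀ A : 𝒜₁,
    (Φ A : X₂ →L[ℂ] X₂) =
      l • ((T : X₁ →L[ℂ] X₂) ∘L (A : X₁ →L[ℂ] X₁) ∘L (T.symm : X₂ →L[ℂ] X₁))

/-- `Φ(A) = l T A* T⁻¹` with `l ^ m = 1` and `T : X₁* → X₂` bounded and invertible. -/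
def IsAntiIsomorphismForm (m : ℕ) (Φ : 𝒜₁ → 𝒜₂) : Prop :=
  ∃ (l : ℂ) (T : StrongDual ℂ X₁ ≃L[ℂ] X₂), l ^ m = 1 ∧ ∀ A : 𝒜₁,
    (Φ A : X₂ →L[ℂ] X₂) =
      l • ((T : StrongDual ℂ X₁ →L[ℂ] X₂) ∘L banachAdjoint (A : X₁ →L[ℂ] X₁) ∘L
        (T.symm : X₂ →L[ℂ] StrongDual ℂ X₁))

end Maps

end

/-! ### Peripheral spectra of products and of operators of rank one and two. -/

section PeripheralSpectrum

variable {X Y : Type*} [NormedAddCommGroup X] [NormedSpace ℂ X]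
  [NormedAddCommGroup Y] [NormedSpace ℂ Y]

/-! Since `S * T` and `T * S` have the same peripheral spectrum, the generalized product may be read
cyclically as `A * W`, where `A` sits at the distinguished position and `W` is the word in the other
positions. Putting a single operator `B` at all other indices, `Φ` preserves the peripheral spectrum
of `A * B ^ (s + 1)` with `m = s + 2`. The classification uses only this (`PreservesMulPow`).

For `B = x ⊗ f` that spectrum is the single point `f (A x) * f x ^ s`, whereas any `A` of rank at
least two admits a rank two `B` producing two opposite nonzero points. Hence rank at most one is
preserved in both directions, and every matrix coefficient `g (Φ A y)` with `g y = 1` is a matrix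
coefficient of `A`, so `Φ` is linear. The bilinear map `(x, f) ↦ Φ (x ⊗ f)` takes values of rank at
most one, which forces it to be `T x ⊗ S f` or `T f ⊗ S x` (`bilin_eq_rankOneOp`). Comparing traces
ties `S` to `T` up to an `m`-th root of unity, the closed graph theorem makes `T` bounded, and `Φ`
is a multiple of a conjugation of `A` or of `A*` (`exists_equiv_of_pairing`).

In the adjoint form, the range condition makes every rank one operator on the dual an adjoint,
whence reflexivity. Adjoints reverse `W`, so a palindromic word suffices for preservation. In
dimension at least two it is also necessary, because triangular matrices spelling numerals in base
`k` separate words of equal length. In dimension at most one the adjoint form is itself a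
conjugation. -/

theorem mem_peripheralSpectrum_iff {T : X →L[ℂ] X} {z : ℂ} :
    z ∈ peripheralSpectrum T ↔ z ∈ spectrum ℂ T ∧ ∀ w ∈ spectrum ℂ T, ‖w‖ ≤ ‖z‖ := by
  refine and_congr_right fun hz => ⟨fun h w hw => ?_, fun h => le_antisymm ?_ ?_⟩
  · have : (‖w‖₊ : ℝ≥0∞) ≤ ‖z‖₊ := by
      rw [h]
      exact le_iSup₂ (f := fun (k : ℂ) (_ : k ∈ spectrum ℂ T) => (‖k‖₊ : ℝ≥0∞)) w hw
    exact_mod_cast this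
  · exact le_iSup₂ (f := fun (k : ℂ) (_ : k ∈ spectrum ℂ T) => (‖k‖₊ : ℝ≥0∞)) z hz
  · refine iSup₂_le fun w hw => ?_
    exact_mod_cast h w hw

theorem peripheralSpectrum_congr {S : X →L[ℂ] X} {T : Y →L[ℂ] Y}
    (h : spectrum ℂ S = spectrum ℂ T) : peripheralSpectrum S = peripheralSpectrum T := by
  ext z
  rw [mem_peripheralSpectrum_iff, mem_peripheralSpectrum_iff, h]

theorem peripheralSpectrum_of_subsingleton [Subsingleton X] (T : X →L[ℂ] X) :
    peripheralSpectrum T = ∅ := by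
  ext z
  simp [mem_peripheralSpectrum_iff, spectrum.of_subsingleton]

/-- The two spectra agree away from `0`. The point `0` is peripheral only when the spectral radius
vanishes, and then nonemptiness of the spectrum puts `0` in both. -/
theorem peripheralSpectrum_mul_comm [CompleteSpace X] (S T : X →L[ℂ] X) :
    peripheralSpectrum (S * T) = peripheralSpectrum (T * S) := by
  rcases subsingleton_or_nontrivial X with hX | hX
  · rw [peripheralSpectrum_of_subsingleton, peripheralSpectrum_of_subsingleton]
  have key : ∀ S T : X →L[ℂ] X, peripheralSpectrum (S * T) ⊆ peripheralSpectrum (T * S) := by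
    intro S T z hz
    rw [mem_peripheralSpectrum_iff] at hz ⊢
    have hmem : ∀ w ≠ 0, (w ∈ spectrum ℂ (S * T) ↔ w ∈ spectrum ℂ (T * S)) := fun w hw => by
      have h := Set.ext_iff.1 (spectrum.nonzero_mul_comm (𝕜 := ℂ) S T) w
      simpa [hw] using h
    have hle : ∀ w ∈ spectrum ℂ (T * S), ‖w‖ ≤ ‖z‖ := fun w hw => by
      by_cases hw0 : w = 0
      · simp [hw0]
      · exact hz.2 w ((hmem w hw0).2 hw)
    refine ⟨?_, hle⟩
    by_cases hz0 : z = 0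
    · obtain ⟨w, hw⟩ := spectrum.nonempty (T * S)
      have hwz := hle w hw
      rw [hz0, norm_zero, norm_le_zero_iff] at hwz
      rw [hz0, ← hwz]
      exact hw
    · exact (hmem z hz0).1 hz.1
  exact (key S T).antisymm (key T S)

theorem mem_spectrum_of_apply_eq_smul {T : X →L[ℂ] X} {z : ℂ} {x : X} (hx : x ≠ 0)
    (h : T x = z • x) : z ∈ spectrum ℂ T := by
  rw [spectrum.mem_iff]
  intro hu
  obtain ⟨u, hu⟩ := hu
  apply hx
  have h1 : (u : X →L[ℂ] X) x = 0 := by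
    rw [hu]
    simp [Algebra.algebraMap_eq_smul_one, h]
  have h2 : ((↑u⁻¹ : X →L[ℂ] X) * (u : X →L[ℂ] X)) x = x := by
    rw [Units.inv_mul]; rfl
  rw [← h2, mul_apply_eq_comp, h1, map_zero]

/-- The operator `z ↦ f z • x` of rank at most one. -/
noncomputable def rankOneOp (x : X) (f : StrongDual ℂ X) : X →L[ℂ] X := f.smulRight x

@[simp] theorem rankOneOp_apply (x : X) (f : StrongDual ℂ X) (z : X) :
    rankOneOp x f z = f z • x := rfl

/-- `rankOneOp` as a bilinear map. -/
noncomputable def rankOneBilin (X : Type*) [NormedAddCommGroup X] [NormedSpace ℂ X] :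
    X →ₗ[ℂ] StrongDual ℂ X →ₗ[ℂ] (X →L[ℂ] X) :=
  LinearMap.mk₂ ℂ rankOneOp
    (fun x y f => by ext z; simp)
    (fun c x f => by ext z; exact smul_comm _ _ _)
    (fun x f g => by ext z; simp [add_smul])
    (fun c x f => by ext z; simp [mul_smul])

@[simp] theorem rankOneBilin_apply (x : X) (f : StrongDual ℂ X) :
    rankOneBilin X x f = rankOneOp x f := rfl

theorem rankOneOp_smul_right (c : ℂ) (x : X) (f : StrongDual ℂ X) :
    rankOneOp x (c • f) = rankOneOp (c • x) f := by
  ext z; simp only [rankOneOp_apply, smul_apply, smul_eq_mul]; module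

@[simp] theorem rankOneOp_zero_left (f : StrongDual ℂ X) : rankOneOp 0 f = 0 := by
  ext z; simp

@[simp] theorem rankOneOp_zero_right (x : X) : rankOneOp x 0 = 0 := by
  ext z; simp

theorem rankOneOp_ne_zero {x : X} {f : StrongDual ℂ X} (hx : x ≠ 0) (hf : f ≠ 0) :
    rankOneOp x f ≠ 0 := by
  intro h
  apply hf
  ext z
  have hz := congr($h z)
  simpa [hx] using hz

theorem mul_rankOneOp (A : X →L[ℂ] X) (x : X) (f : StrongDual ℂ X) :
    A * rankOneOp x f = rankOneOp (A x) f := by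
  ext z; simp

theorem rankOneOp_mul (A : X →L[ℂ] X) (x : X) (f : StrongDual ℂ X) :
    rankOneOp x f * A = rankOneOp x (f ∘L A) := by
  ext z; simp

theorem rankOneOp_pow_succ (x : X) (f : StrongDual ℂ X) (s : ℕ) :
    rankOneOp x f ^ (s + 1) = rankOneOp (f x ^ s • x) f := by
  induction s with
  | zero => simp
  | succ s ih =>
    rw [pow_succ, ih, mul_rankOneOp]
    ext z
    simp only [rankOneOp_apply]
    module

theorem spectrum_subset_of_cube_eq {K : X →L[ℂ] X} {d : ℂ}
    (h : K ^ 3 = d • K) {z : ℂ} (hz : z ∈ spectrum ℂ K) : z = 0 ∨ z ^ 2 = d := by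
  rcases subsingleton_or_nontrivial X with hX | hX
  · rw [spectrum.of_subsingleton] at hz
    exact hz.elim
  have h1 := spectrum.subset_polynomial_aeval K
    (Polynomial.X ^ 3 - Polynomial.C d * Polynomial.X) ⟨z, hz, rfl⟩
  have h2 : Polynomial.aeval K (Polynomial.X ^ 3 - Polynomial.C d * Polynomial.X) = 0 := by
    simp [h, Algebra.algebraMap_eq_smul_one]
  rw [h2, spectrum.zero_eq] at h1
  have h3 : z ^ 3 - d * z = 0 := by simpa using h1
  rcases eq_or_ne z 0 with h0 | h0
  · exact Or.inl h0
  · right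
    apply mul_left_cancel₀ h0
    linear_combination h3

theorem peripheralSpectrum_rankOneOp [CompleteSpace X] [Nontrivial X]
    (x : X) (f : StrongDual ℂ X) : peripheralSpectrum (rankOneOp x f) = {f x} := by
  have hsub : ∀ z ∈ spectrum ℂ (rankOneOp x f), z = 0 ∨ z = f x := by
    intro z hz
    have h1 := spectrum.subset_polynomial_aeval (rankOneOp x f)
      (Polynomial.X ^ 2 - Polynomial.C (f x) * Polynomial.X) ⟨z, hz, rfl⟩
    have h2 : Polynomial.aeval (rankOneOp x f)
        (Polynomial.X ^ 2 - Polynomial.C (f x) * Polynomial.X) = 0 := by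
      ext w
      simp [pow_two, Algebra.algebraMap_eq_smul_one, smul_smul, mul_comm (f w)]
    rw [h2, spectrum.zero_eq] at h1
    have h3 : z * (z - f x) = 0 := by
      have : z ^ 2 - f x * z = 0 := by simpa using h1
      linear_combination this
    rcases mul_eq_zero.1 h3 with h | h
    · exact Or.inl h
    · exact Or.inr (sub_eq_zero.1 h)
  have hmem : f x ∈ spectrum ℂ (rankOneOp x f) := by
    by_cases h0 : f x = 0
    · obtain ⟨w, hw⟩ := spectrum.nonempty (rankOneOp x f)
      rcases hsub w hw with h | h
      · rwa [h0, ← h]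
      · rwa [← h]
    · refine mem_spectrum_of_apply_eq_smul (x := x) ?_ rfl
      rintro rfl
      simp at h0
  ext z
  rw [mem_peripheralSpectrum_iff, Set.mem_singleton_iff]
  constructor
  · rintro ⟨hz, hle⟩
    rcases hsub z hz with h | h
    · have := hle _ hmem
      rw [h, norm_zero, norm_le_zero_iff] at this
      rw [h, this]
    · exact h
  · rintro rfl
    refine ⟨hmem, fun w hw => ?_⟩
    rcases hsub w hw with h | h <;> simp [h]

theorem peripheralSpectrum_mul_rankOneOp [CompleteSpace X] [Nontrivial X]
    (A : X →L[ℂ] X) (x : X) (f : StrongDual ℂ X) :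
    peripheralSpectrum (A * rankOneOp x f) = {f (A x)} := by
  rw [mul_rankOneOp, peripheralSpectrum_rankOneOp]

theorem peripheralSpectrum_rankOneOp_mul [CompleteSpace X] [Nontrivial X]
    (A : X →L[ℂ] X) (x : X) (f : StrongDual ℂ X) :
    peripheralSpectrum (rankOneOp x f * A) = {f (A x)} := by
  rw [rankOneOp_mul, peripheralSpectrum_rankOneOp]
  rfl

/-- A rank two operator whose compression matrix has trace zero and nonzero determinant has
two opposite points in its peripheral spectrum. -/
theorem exists_pair_mem_peripheralSpectrum (u₁ u₂ : X) (f₁ f₂ : StrongDual ℂ X)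
    (htr : f₁ u₁ + f₂ u₂ = 0) (hdet : f₁ u₁ * f₂ u₂ - f₁ u₂ * f₂ u₁ ≠ 0) :
    ∃ c ≠ 0, c ∈ peripheralSpectrum (rankOneOp u₁ f₁ + rankOneOp u₂ f₂) ∧
      -c ∈ peripheralSpectrum (rankOneOp u₁ f₁ + rankOneOp u₂ f₂) := by
  set K := rankOneOp u₁ f₁ + rankOneOp u₂ f₂ with hK
  have h22 : f₂ u₂ = -f₁ u₁ := by linear_combination htr
  -- The matrix `M = (fᵢ uⱼ)` has trace zero, so `M ^ 2 = d` with `d = -det M`. This gives `K ^ 3 =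
  -- d • K`, and the peripheral points are the square roots of `d`.
  set d : ℂ := f₁ u₁ ^ 2 + f₁ u₂ * f₂ u₁ with hd
  have hd0 : d ≠ 0 := by
    intro h
    apply hdet
    rw [h22]
    linear_combination -h
  obtain ⟨c, hc⟩ : ∃ c, c ^ 2 = d := IsAlgClosed.exists_pow_nat_eq d two_pos
  have hc0 : c ≠ 0 := by
    rintro rfl
    simp at hc
    exact hd0 hc.symm
  have hcube : K ^ 3 = d • K := by
    ext z
    simp only [hK, pow_succ, pow_zero, one_mul, mul_apply_eq_comp,
      add_apply, rankOneOp_apply, map_add, map_smul,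
      smul_apply, h22, hd]
    module
  have heig : ∀ e : ℂ, e ^ 2 = d → e ∈ spectrum ℂ K := by
    intro e he
    have he0 : e ≠ 0 := by
      rintro rfl
      simp at he
      exact hd0 he.symm
    have hvec : ∀ a b : ℂ, f₁ u₁ * a + f₁ u₂ * b = e * a → f₂ u₁ * a - f₁ u₁ * b = e * b →
        (a ≠ 0 ∨ b ≠ 0) → e ∈ spectrum ℂ K := by
      intro a b ha hb hab
      have h1 : f₁ (a • u₁ + b • u₂) = e * a := by
        simp only [map_add, map_smul, smul_eq_mul]
        linear_combination ha
      have h2 : f₂ (a • u₁ + b • u₂) = e * b := by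
        simp only [map_add, map_smul, smul_eq_mul, h22]
        linear_combination hb
      refine mem_spectrum_of_apply_eq_smul (x := a • u₁ + b • u₂) ?_ ?_
      · intro h0
        rw [h0, map_zero] at h1 h2
        rcases hab with h | h
        · exact mul_ne_zero he0 h h1.symm
        · exact mul_ne_zero he0 h h2.symm
      · rw [hK, add_apply, rankOneOp_apply, rankOneOp_apply, h1, h2]
        module
    -- Since `(M - e) * (M + e) = 0`, the columns of `M + e` are eigenvectors of `M`; if the first
    -- has zero top entry, the second has bottom entry `2 * e`.
    by_cases h : f₁ u₁ + e = 0
    · refine hvec (f₁ u₂) (e - f₁ u₁) (by ring) (by linear_combination hd - he) (Or.inr ?_)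
      intro h'
      exact he0 (by linear_combination (h + h') / 2)
    · exact hvec (f₁ u₁ + e) (f₂ u₁) (by linear_combination -hd - he) (by ring) (Or.inl h)
  have hper : ∀ e : ℂ, e ^ 2 = d → e ∈ peripheralSpectrum K := by
    intro e he
    rw [mem_peripheralSpectrum_iff]
    refine ⟨heig e he, fun w hw => ?_⟩
    rcases spectrum_subset_of_cube_eq hcube hw with h | h
    · simp [h]
    · have h2 : ‖w‖ ^ 2 = ‖e‖ ^ 2 := by rw [← norm_pow, ← norm_pow, h, he]
      exact (le_abs_self _).trans (abs_le_of_sq_le_sq h2.le (norm_nonneg e))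
  exact ⟨c, hc0, hper c hc, hper (-c) (by rw [neg_sq, hc])⟩

end PeripheralSpectrum

/-! ### Detecting operators of rank at least two. -/

section RankOneCriterion

variable {X : Type*} [NormedAddCommGroup X] [NormedSpace ℂ X]

/-- A vector space is not the union of two proper subspaces, here the two kernels. -/
theorem exists_apply_ne_zero_and {V W : Type*} [AddCommGroup V] [Module ℂ V] [AddCommGroup W]
    [Module ℂ W] {S Q : V →ₗ[ℂ] W} (hS : S ≠ 0) (hQ : Q ≠ 0) : ∃ e, S e ≠ 0 ∧ Q e ≠ 0 := by
  obtain ⟨a, ha⟩ : ∃ a, S a ≠ 0 := by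
    by_contra! h
    exact hS (LinearMap.ext h)
  obtain ⟨b, hb⟩ : ∃ b, Q b ≠ 0 := by
    by_contra! h
    exact hQ (LinearMap.ext h)
  by_cases h1 : Q a = 0
  · by_cases h2 : S b = 0
    · exact ⟨a + b, by simpa [h2] using ha, by simpa [h1] using hb⟩
    · exact ⟨b, h2, hb⟩
  · exact ⟨a, ha, h1⟩

theorem exists_dual_apply_ne_zero_and {S Q : X →L[ℂ] X} (hS : S ≠ 0) (hQ : Q ≠ 0) :
    ∃ (e : X) (f : StrongDual ℂ X), f (S e) ≠ 0 ∧ f (Q e) = 1 := by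
  obtain ⟨e, h1, h2⟩ := exists_apply_ne_zero_and (S := (S : X →ₗ[ℂ] X)) (Q := (Q : X →ₗ[ℂ] X))
    (fun h => hS (ContinuousLinearMap.coe_injective h))
    (fun h => hQ (ContinuousLinearMap.coe_injective h))
  obtain ⟨f, hf, hf'⟩ := SeparatingDual.exists_eq_one_ne_zero_of_ne_zero_pair (R := ℂ) h2 h1
  exact ⟨e, f, hf', hf⟩

/-- An operator which is not of rank at most one has an invertible `2 × 2` compression. -/
theorem exists_compression_det_ne_zero {A : X →L[ℂ] X} (hA : ∀ x f, A ≠ rankOneOp x f) :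
    ∃ (e₁ e₂ : X) (f₁ f₂ : StrongDual ℂ X), f₁ e₁ = 1 ∧ f₁ e₂ = 0 ∧ f₂ e₁ = 0 ∧ f₂ e₂ = 1 ∧
      f₁ (A e₁) * f₂ (A e₂) - f₁ (A e₂) * f₂ (A e₁) ≠ 0 := by
  have hA0 : A ≠ 0 := by simpa using hA 0 0
  have hX : Nontrivial X := by
    by_contra h
    rw [not_nontrivial_iff_subsingleton] at h
    exact hA0 (Subsingleton.elim _ _)
  obtain ⟨e₁, f₁, ha, h11⟩ := exists_dual_apply_ne_zero_and hA0
    (one_ne_zero : (1 : X →L[ℂ] X) ≠ 0)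
  rw [one_apply_eq_self] at h11
  set a := f₁ (A e₁) with haa
  -- A Schur complement: `S` kills `e₁` and `f₁ ∘ S = 0`. Projecting `e` and `f` along `e₁` and `f₁`
  -- makes the pairs biorthogonal, and the determinant becomes `a * f (S e)`.
  set S : X →L[ℂ] X := A - rankOneOp (a⁻¹ • A e₁) (f₁ ∘L A) with hS
  have hS0 : S ≠ 0 := fun h => hA _ _ (sub_eq_zero.1 h)
  set Q : X →L[ℂ] X := 1 - rankOneOp e₁ f₁ with hQ
  have hSQ : ∀ z, S (Q z) = S z := by
    intro z
    simp only [hS, hQ, sub_apply, one_apply_eq_self,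
      rankOneOp_apply, ContinuousLinearMap.comp_apply, map_sub, map_smul, ← haa, smul_smul]
    rw [mul_inv_cancel₀ ha]
    module
  have hQ0 : Q ≠ 0 := by
    intro h
    apply hS0
    ext z
    rw [← hSQ, h]
    simp
  obtain ⟨e, f, hfS, hfQ⟩ := exists_dual_apply_ne_zero_and hS0 hQ0
  have hfQ' : f e - f₁ e * f e₁ = 1 := by simpa [hQ] using hfQ
  have hfS' : f (A e) - f₁ (A e) * a⁻¹ * f (A e₁) ≠ 0 := by
    simpa [hS, mul_assoc] using hfS
  refine ⟨e₁, e - f₁ e • e₁, f₁, f - f e₁ • f₁, h11, by simp [h11], by simp [h11], ?_, ?_⟩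
  · simp [h11]
    linear_combination hfQ'
  · intro h
    apply hfS'
    simp only [map_sub, map_smul, sub_apply, smul_apply,
      smul_eq_mul, ← haa] at h
    apply mul_left_cancel₀ ha
    field_simp
    linear_combination h

/-- The weights make the compression of `A` times `diag (b₁, b₂)` traceless. If the lower left entry
vanishes, the diagonal entries are nonzero and can be swapped with a sign. Otherwise a shear
equalizes the diagonal entries and the weights `1, -1` work. -/
theorem exists_compression_balanced {A : X →L[ℂ] X} (hA : ∀ x f, A ≠ rankOneOp x f) :
    ∃ (e₁ e₂ : X) (f₁ f₂ : StrongDual ℂ X) (b₁ b₂ : ℂ),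
      f₁ e₁ = 1 ∧ f₁ e₂ = 0 ∧ f₂ e₁ = 0 ∧ f₂ e₂ = 1 ∧ b₁ ≠ 0 ∧ b₂ ≠ 0 ∧
      b₁ * f₁ (A e₁) + b₂ * f₂ (A e₂) = 0 ∧
      f₁ (A e₁) * f₂ (A e₂) - f₁ (A e₂) * f₂ (A e₁) ≠ 0 := by
  obtain ⟨e₁, e₂, f₁, f₂, h11, h12, h21, h22, hdet⟩ := exists_compression_det_ne_zero hA
  by_cases h : f₂ (A e₁) = 0
  · rw [h, mul_zero, sub_zero] at hdet
    refine ⟨e₁, e₂, f₁, f₂, f₂ (A e₂), -f₁ (A e₁), h11, h12, h21, h22, right_ne_zero_of_mul hdet,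
      neg_ne_zero.2 (left_ne_zero_of_mul hdet), by ring, ?_⟩
    rwa [h, mul_zero, sub_zero]
  · set t := (f₁ (A e₁) - f₂ (A e₂)) / (2 * f₂ (A e₁)) with ht
    have ht' : t * f₂ (A e₁) * 2 = f₁ (A e₁) - f₂ (A e₂) := by
      rw [ht]; field_simp
    refine ⟨e₁, e₂ + t • e₁, f₁ - t • f₂, f₂, 1, -1, ?_, ?_, h21, ?_, one_ne_zero, by simp, ?_, ?_⟩
    · simp [h11, h21]
    · simp [h11, h12, h21, h22]
    · simp [h21, h22]
    · simp
      linear_combination -ht'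
    · intro h0
      apply hdet
      simp only [map_add, map_smul, sub_apply, smul_apply,
        smul_eq_mul] at h0
      linear_combination h0

theorem diagonal_pow {e₁ e₂ : X} {f₁ f₂ : StrongDual ℂ X} (h11 : f₁ e₁ = 1) (h12 : f₁ e₂ = 0)
    (h21 : f₂ e₁ = 0) (h22 : f₂ e₂ = 1) (c₁ c₂ : ℂ) (s : ℕ) :
    (rankOneOp (c₁ • e₁) f₁ + rankOneOp (c₂ • e₂) f₂) ^ (s + 1) =
      rankOneOp (c₁ ^ (s + 1) • e₁) f₁ + rankOneOp (c₂ ^ (s + 1) • e₂) f₂ := by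
  induction s with
  | zero => simp
  | succ s ih =>
    rw [pow_succ, ih]
    ext z
    simp [h11, h12, h21, h22, smul_smul]
    ring_nf

/-- An operator which is not of rank at most one is detected by a rank two operator. -/
theorem exists_rank_two_peripheralSpectrum_ne {A : X →L[ℂ] X} (hA : ∀ x f, A ≠ rankOneOp x f)
    (s : ℕ) : ∃ (y₁ y₂ : X) (f₁ f₂ : StrongDual ℂ X), ∀ z : ℂ,
      peripheralSpectrum (A * (rankOneOp y₁ f₁ + rankOneOp y₂ f₂) ^ (s + 1)) ≠ {z} := by
  obtain ⟨e₁, e₂, f₁, f₂, b₁, b₂, h11, h12, h21, h22, hb₁, hb₂, htr, hdet⟩ :=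
    exists_compression_balanced hA
  -- Roots are taken so that the `(s + 1)`-th power of the rank two operator has the balanced
  -- weights.
  obtain ⟨c₁, hc₁⟩ := IsAlgClosed.exists_pow_nat_eq b₁ (Nat.succ_pos s)
  obtain ⟨c₂, hc₂⟩ := IsAlgClosed.exists_pow_nat_eq b₂ (Nat.succ_pos s)
  refine ⟨c₁ • e₁, c₂ • e₂, f₁, f₂, fun z hz => ?_⟩
  rw [diagonal_pow h11 h12 h21 h22, hc₁, hc₂, mul_add, mul_rankOneOp, mul_rankOneOp] at hz
  obtain ⟨c, hc, h1, h2⟩ := exists_pair_mem_peripheralSpectrum (A (b₁ • e₁)) (A (b₂ • e₂)) f₁ f₂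
    (by simpa using htr) (by
      intro h
      apply hdet
      apply mul_left_cancel₀ (mul_ne_zero hb₁ hb₂)
      simp only [map_smul, smul_eq_mul] at h
      linear_combination h)
  rw [hz, Set.mem_singleton_iff] at h1 h2
  apply hc
  linear_combination (h1 - h2) / 2

end RankOneCriterion

/-! ### Linear and bilinear families of operators of rank at most one. -/

section RankOneStructure

variable {X : Type*} [NormedAddCommGroup X] [NormedSpace ℂ X]

theorem ne_zero_of_forall_ne_smul {W : Type*} [AddCommGroup W] [Module ℂ W] {v w : W}
    (h : ∀ t : ℂ, v ≠ t • w) : v ≠ 0 := by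
  simpa using h 0

theorem coeff_eq_zero_of_forall_ne_smul {W : Type*} [AddCommGroup W] [Module ℂ W] {v w : W}
    (h : ∀ t : ℂ, v ≠ t • w) (hw : w ≠ 0) {a b : ℂ} (hab : a • v = b • w) : a = 0 ∧ b = 0 := by
  have ha : a = 0 := by
    by_contra ha
    refine h (a⁻¹ * b) ?_
    rw [mul_smul, ← hab, smul_smul, inv_mul_cancel₀ ha, one_smul]
  refine ⟨ha, ?_⟩
  rw [ha, zero_smul] at hab
  exact (smul_eq_zero.1 hab.symm).resolve_right hw

/-- If the sum of two operators of rank one has rank at most one, then their ranges or their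
kernels agree. -/
theorem parallel_of_rankOneOp_add {a c e : X} {b d h : StrongDual ℂ X} (ha : a ≠ 0) (hb : b ≠ 0)
    (hsum : rankOneOp a b + rankOneOp c d = rankOneOp e h) :
    (∃ t : ℂ, c = t • a) ∨ ∃ t : ℂ, d = t • b := by
  by_cases hbd : ∀ z z', b z * d z' = b z' * d z
  · right
    obtain ⟨z, hz⟩ : ∃ z, b z ≠ 0 := by
      by_contra! h0
      exact hb (ContinuousLinearMap.ext h0)
    refine ⟨(b z)⁻¹ * d z, ContinuousLinearMap.ext fun z' => ?_⟩
    have := hbd z z'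
    simp only [smul_apply, smul_eq_mul]
    field_simp
    linear_combination this
  · left
    push Not at hbd
    obtain ⟨z, z', hz⟩ := hbd
    obtain ⟨k, hk⟩ := SeparatingDual.exists_eq_one (R := ℂ) ha
    refine ⟨k c, ?_⟩
    rw [← sub_eq_zero]
    -- The `2 × 2` minor of the sum against `k, k'` and `z, z'` vanishes, as the sum has rank at
    -- most one. It factors as the minor of `a, c` times that of `b, d`, and the latter is nonzero.
    refine SeparatingDual.eq_zero_of_forall_dual_eq_zero (R := ℂ) fun k' => ?_
    have hev : ∀ w, b w • a + d w • c = h w • e := fun w => congr($hsum w)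
    have h1 := congr(k $(hev z))
    have h2 := congr(k $(hev z'))
    have h3 := congr(k' $(hev z))
    have h4 := congr(k' $(hev z'))
    simp only [map_add, map_smul, smul_eq_mul, hk, mul_one] at h1 h2 h3 h4
    apply mul_left_cancel₀ (sub_ne_zero.2 hz)
    simp only [map_sub, map_smul, smul_eq_mul]
    linear_combination (b z' * k' a + d z' * k' c) * h1 + (h z * k e) * h4 -
      (b z * k' a + d z * k' c) * h2 - (h z' * k e) * h3

/-- A linear space of operators of rank at most one has a common range or a common kernel. -/
theorem common_range_or_common_ker {V : Type*} [AddCommGroup V] [Module ℂ V]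
    (Θ : V →ₗ[ℂ] (X →L[ℂ] X)) (hΘ : ∀ v, ∃ y g, Θ v = rankOneOp y g) :
    (∃ y, ∀ v, ∃ g, Θ v = rankOneOp y g) ∨ ∃ g, ∀ v, ∃ y, Θ v = rankOneOp y g := by
  by_cases h0 : ∀ v, Θ v = 0
  · exact Or.inl ⟨0, fun v => ⟨0, by simp [h0]⟩⟩
  push Not at h0
  obtain ⟨v₀, hv₀⟩ := h0
  obtain ⟨y₀, g₀, h₀⟩ := hΘ v₀
  have hy₀ : y₀ ≠ 0 := by rintro rfl; simp [h₀] at hv₀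
  have hg₀ : g₀ ≠ 0 := by rintro rfl; simp [h₀] at hv₀
  by_cases hL : ∀ v, ∃ g, Θ v = rankOneOp y₀ g
  · exact Or.inl ⟨y₀, hL⟩
  right
  push Not at hL
  obtain ⟨v₁, hv₁⟩ := hL
  have hadj : ∀ v v' y g y' g', Θ v = rankOneOp y g → Θ v' = rankOneOp y' g' → y ≠ 0 → g ≠ 0 →
      (∃ t : ℂ, y' = t • y) ∨ ∃ t : ℂ, g' = t • g := by
    intro v v' y g y' g' h h' hy hg
    obtain ⟨e, k, hek⟩ := hΘ (v + v')
    rw [map_add, h, h'] at hek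
    exact parallel_of_rankOneOp_add hy hg hek
  obtain ⟨y₁, hy₁⟩ : ∃ y₁, Θ v₁ = rankOneOp y₁ g₀ := by
    obtain ⟨y, g, h⟩ := hΘ v₁
    rcases hadj v₀ v₁ _ _ _ _ h₀ h hy₀ hg₀ with ⟨t, rfl⟩ | ⟨t, rfl⟩
    · exact absurd (h.trans (rankOneOp_smul_right t y₀ g).symm) (hv₁ _)
    · exact ⟨t • y, h.trans (rankOneOp_smul_right t y g₀)⟩
  have hne : ∀ t : ℂ, y₁ ≠ t • y₀ := by
    rintro t rfl
    exact hv₁ _ (hy₁.trans (rankOneOp_smul_right t y₀ g₀).symm)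
  have hy₁0 : y₁ ≠ 0 := by simpa using hne 0
  refine ⟨g₀, fun v => ?_⟩
  obtain ⟨a, b, hab⟩ := hΘ v
  -- A value whose functional is not a multiple of `g₀` would have its range in both lines spanned
  -- by `y₀` and `y₁`, hence be zero.
  rcases hadj v₀ v _ _ _ _ h₀ hab hy₀ hg₀ with ⟨t, ht⟩ | ⟨t, rfl⟩
  · rcases hadj v₁ v _ _ _ _ hy₁ hab hy₁0 hg₀ with ⟨t', ht'⟩ | ⟨t', rfl⟩
    · by_cases h : t' = 0
      · exact ⟨0, by rw [hab, ht', h]; simp⟩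
      · exfalso
        refine hne (t'⁻¹ * t) ?_
        rw [mul_smul, ← ht, ht', smul_smul, inv_mul_cancel₀ h, one_smul]
    · exact ⟨_, hab.trans (rankOneOp_smul_right _ _ _)⟩
  · exact ⟨_, hab.trans (rankOneOp_smul_right _ _ _)⟩

/-- A bilinear map with values of rank one, one of whose left sections has a common range and
one of whose right sections has a common kernel, is elementary. -/
theorem exists_eq_rankOneOp_of_bilinear {U V : Type*} [AddCommGroup U] [Module ℂ U]
    [AddCommGroup V] [Module ℂ V] (B : U →ₗ[ℂ] V →ₗ[ℂ] (X →L[ℂ] X))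
    (hB : ∀ u v, ∃ y g, B u v = rankOneOp y g) (hB0 : ∀ u v, B u v = 0 → u = 0 ∨ v = 0)
    {u₀ : U} {v₀ : V} (hu₀ : u₀ ≠ 0) (hv₀ : v₀ ≠ 0)
    (hL : ∃ y, ∀ v, ∃ g, B u₀ v = rankOneOp y g) (hR : ∃ g, ∀ u, ∃ y, B u v₀ = rankOneOp y g) :
    ∃ (T : U →ₗ[ℂ] X) (S : V →ₗ[ℂ] StrongDual ℂ X), ∀ u v, B u v = rankOneOp (T u) (S v) := by
  have hB00 : B u₀ v₀ ≠ 0 := fun h => (hB0 _ _ h).elim hu₀ hv₀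
  obtain ⟨z₀, hz₀⟩ : ∃ z, B u₀ v₀ z ≠ 0 := by
    by_contra! h
    exact hB00 (ContinuousLinearMap.ext h)
  obtain ⟨k₀, hk₀⟩ := SeparatingDual.exists_eq_one (R := ℂ) hz₀
  -- Evaluating at `z₀` and `k₀` with `k₀ (B u₀ v₀ z₀) = 1` normalizes `T` and `S`, so that the
  -- elementary formula holds on both sections with no stray scalar.
  let T : U →ₗ[ℂ] X :=
    { toFun := fun u => B u v₀ z₀
      map_add' := fun u u' => by simp
      map_smul' := fun c u => by simp }
  let S : V →ₗ[ℂ] StrongDual ℂ X :=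
    { toFun := fun v => k₀ ∘L B u₀ v
      map_add' := fun v v' => by ext; simp
      map_smul' := fun c v => by ext; simp }
  have hT : ∀ u, T u = B u v₀ z₀ := fun _ => rfl
  have hS : ∀ v z, S v z = k₀ (B u₀ v z) := fun _ _ => rfl
  have hl : ∀ v, B u₀ v = rankOneOp (T u₀) (S v) := by
    obtain ⟨y, hy⟩ := hL
    intro v
    obtain ⟨g, hg⟩ := hy v
    obtain ⟨g', hg'⟩ := hy v₀
    have h1 : g' z₀ * k₀ y = 1 := by
      rw [hg'] at hk₀
      simpa using hk₀
    ext z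
    simp only [rankOneOp_apply, hT, hS, hg, hg', map_smul, smul_smul, smul_eq_mul]
    congr 1
    linear_combination -g z * h1
  have hr : ∀ u, B u v₀ = rankOneOp (T u) (S v₀) := by
    obtain ⟨g, hg⟩ := hR
    intro u
    obtain ⟨y, hy⟩ := hg u
    obtain ⟨y', hy'⟩ := hg u₀
    have h1 : g z₀ * k₀ y' = 1 := by
      rw [hy'] at hk₀
      simpa using hk₀
    ext z
    simp only [rankOneOp_apply, hT, hS, hy, hy', map_smul, smul_smul, smul_eq_mul]
    congr 1
    linear_combination -g z * h1
  have hTu₀ : T u₀ ≠ 0 := hz₀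
  have hSv₀ : S v₀ ≠ 0 := by
    intro h
    have := hS v₀ z₀
    rw [h, hk₀] at this
    simp at this
  refine ⟨T, S, fun u v => ?_⟩
  by_cases hu : ∃ t : ℂ, T u = t • T u₀
  · obtain ⟨t, ht⟩ := hu
    have h0 : B (u - t • u₀) v₀ = 0 := by
      rw [map_sub, map_smul, LinearMap.sub_apply, LinearMap.smul_apply, hr, hr, ht]
      ext z
      simp [smul_smul, mul_comm]
    have hut : u = t • u₀ := sub_eq_zero.1 ((hB0 _ _ h0).resolve_right hv₀)
    rw [ht, hut, map_smul, LinearMap.smul_apply, hl]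
    ext z
    simp [smul_smul, mul_comm]
  by_cases hv : ∃ t : ℂ, S v = t • S v₀
  · obtain ⟨t, ht⟩ := hv
    have h0 : B u₀ (v - t • v₀) = 0 := by
      rw [map_sub, map_smul, hl, hl, ht]
      ext z
      simp [smul_smul]
    have hvt : v = t • v₀ := sub_eq_zero.1 ((hB0 _ _ h0).resolve_left hu₀)
    rw [ht, hvt, map_smul, hr]
    ext z
    simp [smul_smul]
  push Not at hu hv
  obtain ⟨a, b, hab⟩ := hB u v
  have hu0 : u ≠ 0 := by rintro rfl; exact ne_zero_of_forall_ne_smul hu (map_zero T)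
  have hv0 : v ≠ 0 := by rintro rfl; exact ne_zero_of_forall_ne_smul hv (map_zero S)
  have hBuv : B u v ≠ 0 := fun h => (hB0 _ _ h).elim hu0 hv0
  have ha0 : a ≠ 0 := by rintro rfl; simp [hab] at hBuv
  have hb0 : b ≠ 0 := by rintro rfl; simp [hab] at hBuv
  have hTu : T u ≠ 0 := ne_zero_of_forall_ne_smul hu
  have hSv : S v ≠ 0 := ne_zero_of_forall_ne_smul hv
  have hsum : B (u + u₀) (v + v₀) = rankOneOp a b + rankOneOp (T u) (S v₀) +
      rankOneOp (T u₀) (S v) + rankOneOp (T u₀) (S v₀) := by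
    simp only [map_add, LinearMap.add_apply, hab, hl, hr]
    abel
  obtain ⟨e, h, heh⟩ := hB (u + u₀) (v + v₀)
  rw [hsum] at heh
  -- Here `T u, T u₀` and `S v, S v₀` are independent pairs. The value `a ⊗ b` shares a line with
  -- each of `T u ⊗ S v₀` and `T u₀ ⊗ S v`. Of the four combinations two contradict independence; of
  -- the other two, the rank of `B (u + u₀) (v + v₀)` excludes the one with `a ∥ T u₀` and forces
  -- coefficient `1` in the one with `a ∥ T u`.
  have adj1 : (∃ t : ℂ, a = t • T u) ∨ ∃ t : ℂ, b = t • S v₀ := by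
    obtain ⟨e, h, heh⟩ := hB u (v₀ + v)
    rw [map_add, hab, hr] at heh
    exact parallel_of_rankOneOp_add hTu hSv₀ heh
  have adj2 : (∃ t : ℂ, a = t • T u₀) ∨ ∃ t : ℂ, b = t • S v := by
    obtain ⟨e, h, heh⟩ := hB (u₀ + u) v
    rw [map_add, LinearMap.add_apply, hab, hl] at heh
    exact parallel_of_rankOneOp_add hTu₀ hSv heh
  rcases adj1 with ⟨t, ht⟩ | ⟨t, ht⟩ <;> rcases adj2 with ⟨t', ht'⟩ | ⟨t', ht'⟩
  · exfalso
    have ht0 : t ≠ 0 := by rintro rfl; simp [ht] at ha0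
    refine hu (t⁻¹ * t') ?_
    rw [mul_smul, ← ht', ht, smul_smul, inv_mul_cancel₀ ht0, one_smul]
  · have heq : rankOneOp (T u₀) (S v + S v₀) + rankOneOp (T u) ((t * t') • S v + S v₀) =
        rankOneOp e h := by
      rw [← heh, ht, ht']
      ext z
      simp only [add_apply, rankOneOp_apply, smul_apply, smul_eq_mul]
      module
    have hne : S v + S v₀ ≠ 0 := by
      intro h0
      refine hv (-1) (ContinuousLinearMap.ext fun z => ?_)
      have := congr($h0 z)
      simp only [add_apply, zero_apply, smul_apply, smul_eq_mul] at this ⊢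
      linear_combination this
    rcases parallel_of_rankOneOp_add hTu₀ hne heq with ⟨r, hr'⟩ | ⟨r, hr'⟩
    · exact absurd hr' (hu r)
    · have h1 : (t * t' - r) • S v = (r - 1) • S v₀ := by
        ext z
        have := congr($hr' z)
        simp only [add_apply, smul_apply, smul_eq_mul] at this ⊢
        linear_combination this
      obtain ⟨h2, h3⟩ := coeff_eq_zero_of_forall_ne_smul hv hSv₀ h1
      have h4 : t * t' = 1 := by linear_combination h2 + h3
      rw [hab, ht, ht']
      ext z
      simp only [rankOneOp_apply, smul_apply, smul_eq_mul]
      rw [smul_smul]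
      congr 1
      linear_combination S v z * h4
  · exfalso
    have heq : rankOneOp (T u₀) ((t * t' + 1) • S v₀ + S v) + rankOneOp (T u) (S v₀) =
        rankOneOp e h := by
      rw [← heh, ht, ht']
      ext z
      simp only [add_apply, rankOneOp_apply, smul_apply, smul_eq_mul]
      module
    have hne : (t * t' + 1) • S v₀ + S v ≠ 0 := by
      intro h0
      refine hv (-(t * t' + 1)) (ContinuousLinearMap.ext fun z => ?_)
      have := congr($h0 z)
      simp only [add_apply, zero_apply, smul_apply, smul_eq_mul] at this ⊢
      linear_combination this
    rcases parallel_of_rankOneOp_add hTu₀ hne heq with ⟨r, hr'⟩ | ⟨r, hr'⟩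
    · exact hu r hr'
    · have h1 : r • S v = (1 - r * (t * t' + 1)) • S v₀ := by
        ext z
        have := congr($hr' z)
        simp only [add_apply, smul_apply, smul_eq_mul] at this ⊢
        linear_combination -this
      obtain ⟨h2, h3⟩ := coeff_eq_zero_of_forall_ne_smul hv hSv₀ h1
      rw [h2] at h3
      simp at h3
  · exfalso
    obtain ⟨h2, -⟩ := coeff_eq_zero_of_forall_ne_smul hv hSv₀ (ht'.symm.trans ht)
    apply hb0
    rw [ht', h2]
    exact zero_smul ℂ (S v)

end RankOneStructure

/-! ### From a trace identity to a bounded intertwining isomorphism. -/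

section Implementation

variable {X : Type*} [NormedAddCommGroup X] [NormedSpace ℂ X]

/-- Two separating bilinear pairings with equal `n`-th powers differ by an `n`-th root of
unity. -/
theorem exists_scalar_of_pow_eq {U V : Type*} [AddCommGroup U] [Module ℂ U] [AddCommGroup V]
    [Module ℂ V] (b β : U →ₗ[ℂ] V →ₗ[ℂ] ℂ) {n : ℕ} (hn : n ≠ 0)
    (hpow : ∀ u v, β u v ^ n = b u v ^ n) (hb : ∃ u v, b u v ≠ 0) (hsep : ∀ u ≠ 0, b u ≠ 0) :
    ∃ l : ℂ, l ^ n = 1 ∧ ∀ u v, β u v = l * b u v := by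
  have hzero : ∀ u v, b u v = 0 → β u v = 0 := fun u v h => by
    have := hpow u v
    rw [h, zero_pow hn] at this
    exact pow_eq_zero_iff hn |>.1 this
  have hcross : ∀ u v v', β u v * b u v' = β u v' * b u v := by
    intro u v v'
    -- This vector is chosen in the kernel of `b u`, hence also of `β u`. So the two functionals are
    -- proportional.
    have h : b u (b u v' • v - b u v • v') = 0 := by simp [mul_comm]
    have h' := hzero _ _ h
    simp only [map_sub, map_smul, smul_eq_mul] at h'
    linear_combination h'
  have hcross' : ∀ u u' v, β u v * b u' v = β u' v * b u v := by
    intro u u' v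
    have h : b (b u' v • u - b u v • u') v = 0 := by simp [mul_comm]
    have h' := hzero _ _ h
    simp only [map_sub, map_smul, smul_eq_mul, LinearMap.sub_apply, LinearMap.smul_apply] at h'
    linear_combination h'
  obtain ⟨u₀, v₀, h₀⟩ := hb
  have hl : (β u₀ v₀ / b u₀ v₀) ^ n = 1 := by
    rw [div_pow, hpow, div_self (pow_ne_zero _ h₀)]
  refine ⟨β u₀ v₀ / b u₀ v₀, hl, fun u v => ?_⟩
  rcases eq_or_ne u 0 with rfl | hu
  · simp
  have hbu₀ : b u₀ ≠ 0 := fun h => h₀ (by simp [h])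
  -- The ratios at `(u, v)` and `(u₀, v₀)` are compared through `(u, w)` and `(u₀, w)`, where
  -- neither denominator vanishes.
  obtain ⟨w, hw, hw₀⟩ := exists_apply_ne_zero_and (hsep u hu) hbu₀
  have h1 := hcross u₀ v₀ w
  have h2 := hcross' u₀ u w
  have h3 := hcross u v w
  field_simp
  apply mul_right_cancel₀ (mul_ne_zero hw hw₀)
  linear_combination (b u₀ v₀ * b u₀ w) * h3 - (b u v * b u₀ v₀) * h2 - (b u v * b u w) * h1

/-- An intertwining relation up to a pairing yields a topological isomorphism. -/
theorem exists_equiv_of_pairing [CompleteSpace X] {U V ι : Type*} [NormedAddCommGroup U]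
    [NormedSpace ℂ U] [CompleteSpace U] [AddCommGroup V] [Module ℂ V]
    (b : U →ₗ[ℂ] V →ₗ[ℂ] ℂ) (hcont : ∀ v, Continuous fun u => b u v)
    (hb : ∃ u v, b u v ≠ 0) (hsep : ∀ u ≠ 0, b u ≠ 0)
    (T : U →ₗ[ℂ] X) (S : V →ₗ[ℂ] StrongDual ℂ X) (hT : Function.Surjective T)
    (hS : Function.Surjective S) (s : ℕ) (hpow : ∀ u v, S v (T u) ^ (s + 2) = b u v ^ (s + 2))
    (ψ : ι → X →L[ℂ] X) (α : ι → U →L[ℂ] U)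
    (hrel : ∀ j u v, S v (ψ j (T u)) * S v (T u) ^ s = b (α j u) v * b u v ^ s) :
    ∃ (l : ℂ) (E : U ≃L[ℂ] X), l ^ (s + 2) = 1 ∧
      ∀ j, ψ j = l • ((E : U →L[ℂ] X) ∘L α j ∘L (E.symm : X →L[ℂ] U)) := by
  let β : U →ₗ[ℂ] V →ₗ[ℂ] ℂ := LinearMap.mk₂ ℂ (fun u v => S v (T u))
    (by simp) (by simp) (by simp) (by simp)
  obtain ⟨l, hl, hlb⟩ := exists_scalar_of_pow_eq b β (Nat.succ_ne_zero (s + 1)) hpow hb hsep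
  have hST : ∀ u v, S v (T u) = l * b u v := hlb
  have hl0 : l ≠ 0 := by
    rintro rfl
    simp at hl
  have hl' : l ^ (s + 2) = 1 := hl
  have hext : ∀ {y y' : X}, (∀ v, S v y = S v y') → y = y' := by
    intro y y' h
    rw [← sub_eq_zero]
    refine SeparatingDual.eq_zero_of_forall_dual_eq_zero (R := ℂ) fun k => ?_
    obtain ⟨v, rfl⟩ := hS k
    rw [map_sub, h, sub_self]
  have hinj : Function.Injective T := by
    rw [← LinearMap.ker_eq_bot, LinearMap.ker_eq_bot']
    intro u hu
    by_contra h
    apply hsep u h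
    ext v
    have := hST u v
    rw [hu, map_zero] at this
    simpa [hl0] using this.symm
  have hTc : Continuous T := by
    -- The limit is identified through the functionals `S v`, which exhaust the dual and become the
    -- continuous maps `l * b u v` after composing with `T`.
    refine T.continuous_of_seq_closed_graph fun w u y hw hy => ?_
    refine hext fun v => ?_
    have h1 : Filter.Tendsto (fun n => S v (T (w n))) Filter.atTop (nhds (S v y)) :=
      ((S v).continuous.tendsto y).comp hy
    have h2 : Filter.Tendsto (fun n => S v (T (w n))) Filter.atTop (nhds (S v (T u))) := by
      simp only [hST]
      exact (((hcont v).tendsto u).comp hw).const_mul l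
    exact tendsto_nhds_unique h1 h2
  have hmain : ∀ j u, ψ j (T u) = l • T (α j u) := by
    intro j u
    -- Cancelling `b u v ^ s` needs `b u v ≠ 0`; any other `v` is the difference of two such
    -- vectors, `v + v₁` and `v₁`.
    have hgood : ∀ v, b u v ≠ 0 → S v (ψ j (T u)) = S v (l • T (α j u)) := by
      intro v hv
      have h := hrel j u v
      rw [hST u v] at h
      rw [map_smul, smul_eq_mul, hST]
      apply mul_right_cancel₀ (mul_ne_zero (pow_ne_zero s hl0) (pow_ne_zero s hv))
      linear_combination h - (b (α j u) v * b u v ^ s) * hl'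
    rcases eq_or_ne u 0 with rfl | hu
    · simp
    obtain ⟨v₁, hv₁⟩ : ∃ v, b u v ≠ 0 := by
      by_contra! h
      exact hsep u hu (LinearMap.ext h)
    refine hext fun v => ?_
    by_cases hv : b u v = 0
    · have h1 := hgood (v + v₁) (by simpa [hv] using hv₁)
      have h2 := hgood v₁ hv₁
      rw [map_add, add_apply, add_apply, h2] at h1
      exact add_right_cancel h1
    · exact hgood v hv
  let E : U ≃L[ℂ] X := ContinuousLinearEquiv.ofBijective ⟨T, hTc⟩
    (LinearMap.ker_eq_bot.2 hinj) (LinearMap.range_eq_top.2 hT)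
  have hE : ∀ u, E u = T u := fun _ => rfl
  refine ⟨l, E, hl, fun j => ?_⟩
  ext y
  obtain ⟨u, rfl⟩ := E.surjective y
  simp only [smul_apply, ContinuousLinearMap.comp_apply, ContinuousLinearEquiv.coe_coe,
    ContinuousLinearEquiv.symm_apply_apply]
  rw [hE, hE, hmain]

end Implementation

/-! ### Maps preserving the peripheral spectrum of `A * B ^ (s + 1)`. -/

section Preserver

variable {X₁ X₂ : Type*} [NormedAddCommGroup X₁] [NormedSpace ℂ X₁]
  [NormedAddCommGroup X₂] [NormedSpace ℂ X₂]

theorem eq_of_forall_dual_apply_eq {X : Type*} [NormedAddCommGroup X] [NormedSpace ℂ X]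
    {S S' : X →L[ℂ] X} (h : ∀ (y : X) (g : StrongDual ℂ X), g y = 1 → g (S y) = g (S' y)) :
    S = S' := by
  have hgood : ∀ (y : X) (g : StrongDual ℂ X), g y ≠ 0 → g (S y) = g (S' y) := by
    intro y g hg
    have h1 := h y ((g y)⁻¹ • g) (by simp [hg])
    simpa [hg] using h1
  ext y
  rcases eq_or_ne y 0 with rfl | hy
  · simp
  obtain ⟨g₀, hg₀⟩ := SeparatingDual.exists_eq_one (R := ℂ) hy
  rw [← sub_eq_zero]
  refine SeparatingDual.eq_zero_of_forall_dual_eq_zero (R := ℂ) fun g => ?_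
  rw [map_sub, sub_eq_zero]
  by_cases hg : g y = 0
  · have h1 := hgood y (g + g₀) (by simp [hg, hg₀])
    have h2 := h y g₀ hg₀
    simp only [add_apply] at h1
    linear_combination h1 - h2
  · exact hgood y g hg

/-- The trace does not depend on the representation, being the only peripheral point. -/
theorem trace_eq_of_rankOneOp_eq {X : Type*} [NormedAddCommGroup X] [NormedSpace ℂ X]
    [CompleteSpace X] [Nontrivial X] {a a' : X} {b b' : StrongDual ℂ X}
    (h : rankOneOp a b = rankOneOp a' b') : b a = b' a' := by
  rw [← Set.singleton_eq_singleton_iff, ← peripheralSpectrum_rankOneOp, h,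
    peripheralSpectrum_rankOneOp]

theorem trace_mul_eq_of_rankOneOp_eq {X : Type*} [NormedAddCommGroup X] [NormedSpace ℂ X]
    [CompleteSpace X] [Nontrivial X] {a a' c c' : X} {b b' d d' : StrongDual ℂ X}
    (h : rankOneOp a b = rankOneOp a' b') (h' : rankOneOp c d = rankOneOp c' d') :
    b c * d a = b' c' * d' a' := by
  have key : ∀ (a c : X) (b d : StrongDual ℂ X),
      peripheralSpectrum (rankOneOp a b * rankOneOp c d) = {b c * d a} := fun a c b d => by
    rw [peripheralSpectrum_mul_rankOneOp]
    simp
  rw [← Set.singleton_eq_singleton_iff, ← key, h, h', key]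

/-- A map on a space of operators containing all operators of rank at most two, with all operators
of rank at most two in its range, that preserves the peripheral spectrum of `A * B ^ (s + 1)`. -/
structure PreservesMulPow (𝒜 : NonUnitalSubalgebra ℂ (X₁ →L[ℂ] X₁)) (φ : 𝒜 → (X₂ →L[ℂ] X₂))
    (s : ℕ) : Prop where
  mem : ∀ x f x' f', rankOneOp x f + rankOneOp x' f' ∈ 𝒜
  range : ∀ y g y' g', ∃ A, φ A = rankOneOp y g + rankOneOp y' g'
  peripheralSpectrum_eq : ∀ A B : 𝒜,
    peripheralSpectrum (φ A * φ B ^ (s + 1)) =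
      peripheralSpectrum ((A : X₁ →L[ℂ] X₁) * (B : X₁ →L[ℂ] X₁) ^ (s + 1))

namespace PreservesMulPow

variable {𝒜 : NonUnitalSubalgebra ℂ (X₁ →L[ℂ] X₁)} {φ : 𝒜 → (X₂ →L[ℂ] X₂)} {s : ℕ}

theorem rankOneOp_mem (h : PreservesMulPow 𝒜 φ s) (x : X₁) (f : StrongDual ℂ X₁) :
    rankOneOp x f ∈ 𝒜 := by
  simpa using h.mem x f 0 0

theorem exists_eq_rankOneOp (h : PreservesMulPow 𝒜 φ s) (y : X₂) (g : StrongDual ℂ X₂) :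
    ∃ A, φ A = rankOneOp y g := by
  simpa using h.range y g 0 0

/-- A product with a rank one factor has a one-point peripheral spectrum, while an image of higher
rank would be exposed by a rank two operator, which lies in the range. -/
theorem map_rankOne [CompleteSpace X₁] [Nontrivial X₁] (h : PreservesMulPow 𝒜 φ s) {A : 𝒜} {x : X₁} {f : StrongDual ℂ X₁}
    (hA : (A : X₁ →L[ℂ] X₁) = rankOneOp x f) : ∃ y g, φ A = rankOneOp y g := by
  by_contra! hne
  obtain ⟨y₁, y₂, g₁, g₂, hz⟩ := exists_rank_two_peripheralSpectrum_ne hne s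
  obtain ⟨B, hB⟩ := h.range y₁ g₁ y₂ g₂
  rw [← hB, h.peripheralSpectrum_eq, hA, peripheralSpectrum_rankOneOp_mul] at hz
  exact hz _ rfl

theorem rankOne_of_map [CompleteSpace X₂] [Nontrivial X₂] (h : PreservesMulPow 𝒜 φ s) {A : 𝒜} {y : X₂} {g : StrongDual ℂ X₂}
    (hA : φ A = rankOneOp y g) : ∃ x f, (A : X₁ →L[ℂ] X₁) = rankOneOp x f := by
  by_contra! hne
  obtain ⟨x₁, x₂, f₁, f₂, hz⟩ := exists_rank_two_peripheralSpectrum_ne hne s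
  have hB := h.peripheralSpectrum_eq A ⟨_, h.mem x₁ f₁ x₂ f₂⟩
  rw [hA, peripheralSpectrum_rankOneOp_mul] at hB
  exact hz _ hB.symm

variable [CompleteSpace X₁] [CompleteSpace X₂] [Nontrivial X₁] [Nontrivial X₂]

/-- With `B` fixed, the right-hand side is linear in `A`; this is where linearity of `φ` comes from.
-/
theorem apply_mul_pow (h : PreservesMulPow 𝒜 φ s) {B : 𝒜} {x : X₁} {f : StrongDual ℂ X₁}
    {y : X₂} {g : StrongDual ℂ X₂} (hB : (B : X₁ →L[ℂ] X₁) = rankOneOp x f)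
    (hφB : φ B = rankOneOp y g) (A : 𝒜) :
    g (φ A y) * g y ^ s = f ((A : X₁ →L[ℂ] X₁) x) * f x ^ s := by
  have h1 := h.peripheralSpectrum_eq A B
  rw [hB, hφB, rankOneOp_pow_succ, rankOneOp_pow_succ, peripheralSpectrum_mul_rankOneOp,
    peripheralSpectrum_mul_rankOneOp, Set.singleton_eq_singleton_iff] at h1
  simp only [map_smul, smul_eq_mul] at h1
  linear_combination h1

theorem trace_pow (h : PreservesMulPow 𝒜 φ s) {B : 𝒜} {x : X₁} {f : StrongDual ℂ X₁}
    {y : X₂} {g : StrongDual ℂ X₂} (hB : (B : X₁ →L[ℂ] X₁) = rankOneOp x f)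
    (hφB : φ B = rankOneOp y g) : g y ^ (s + 2) = f x ^ (s + 2) := by
  have h1 := h.apply_mul_pow hB hφB B
  rw [hB, hφB] at h1
  simp only [rankOneOp_apply, map_smul, smul_eq_mul] at h1
  linear_combination h1

theorem exists_test (h : PreservesMulPow 𝒜 φ s) (y : X₂) (g : StrongDual ℂ X₂) (hg : g y = 1) :
    ∃ (x : X₁) (f : StrongDual ℂ X₁), ∀ A : 𝒜, g (φ A y) = f ((A : X₁ →L[ℂ] X₁) x) := by
  obtain ⟨B, hφB⟩ := h.exists_eq_rankOneOp y g
  obtain ⟨x, f, hB⟩ := h.rankOne_of_map hφB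
  refine ⟨x, f x ^ s • f, fun A => ?_⟩
  have h1 := h.apply_mul_pow hB hφB A
  rw [hg, one_pow, mul_one] at h1
  rw [h1, smul_apply, smul_eq_mul, mul_comm]

theorem map_add (h : PreservesMulPow 𝒜 φ s) (A B : 𝒜) : φ (A + B) = φ A + φ B := by
  refine eq_of_forall_dual_apply_eq fun y g hg => ?_
  obtain ⟨x, f, hf⟩ := h.exists_test y g hg
  simp [hf]

theorem map_smul (h : PreservesMulPow 𝒜 φ s) (c : ℂ) (A : 𝒜) : φ (c • A) = c • φ A := by
  refine eq_of_forall_dual_apply_eq fun y g hg => ?_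
  obtain ⟨x, f, hf⟩ := h.exists_test y g hg
  simp [hf]

theorem eq_zero_of_map_eq_zero (h : PreservesMulPow 𝒜 φ s) {A : 𝒜} (hA : φ A = 0) :
    (A : X₁ →L[ℂ] X₁) = 0 := by
  refine eq_of_forall_dual_apply_eq fun x f hf => ?_
  obtain ⟨y, g, hg⟩ := h.map_rankOne (A := ⟨_, h.rankOneOp_mem x f⟩) rfl
  have h1 := h.apply_mul_pow rfl hg A
  rw [hA, hf] at h1
  simpa using h1.symm

/-- The bilinear map `(x, f) ↦ φ (rankOneOp x f)`. -/
noncomputable def bilin (h : PreservesMulPow 𝒜 φ s) :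
    X₁ →ₗ[ℂ] StrongDual ℂ X₁ →ₗ[ℂ] (X₂ →L[ℂ] X₂) :=
  LinearMap.mk₂ ℂ (fun x f => φ ⟨rankOneOp x f, h.rankOneOp_mem x f⟩)
    (fun x y f => by
      rw [← h.map_add]
      congr 1
      exact Subtype.ext (LinearMap.map_add₂ (rankOneBilin X₁) x y f))
    (fun c x f => by
      rw [← h.map_smul]
      congr 1
      exact Subtype.ext (LinearMap.map_smul₂ (rankOneBilin X₁) c x f))
    (fun x f g => by
      rw [← h.map_add]
      congr 1
      exact Subtype.ext ((rankOneBilin X₁ x).map_add f g))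
    (fun c x f => by
      rw [← h.map_smul]
      congr 1
      exact Subtype.ext ((rankOneBilin X₁ x).map_smul c f))

theorem bilin_apply (h : PreservesMulPow 𝒜 φ s) (x : X₁) (f : StrongDual ℂ X₁) :
    h.bilin x f = φ ⟨rankOneOp x f, h.rankOneOp_mem x f⟩ := rfl

theorem bilin_rankOne (h : PreservesMulPow 𝒜 φ s) (x : X₁) (f : StrongDual ℂ X₁) :
    ∃ y g, h.bilin x f = rankOneOp y g :=
  h.map_rankOne rfl

theorem bilin_eq_zero (h : PreservesMulPow 𝒜 φ s) (x : X₁) (f : StrongDual ℂ X₁)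
    (h0 : h.bilin x f = 0) : x = 0 ∨ f = 0 := by
  by_contra! hne
  exact rankOneOp_ne_zero hne.1 hne.2 (h.eq_zero_of_map_eq_zero h0)

theorem exists_bilin_eq (h : PreservesMulPow 𝒜 φ s) (y : X₂) (g : StrongDual ℂ X₂) :
    ∃ x f, h.bilin x f = rankOneOp y g := by
  obtain ⟨A, hA⟩ := h.exists_eq_rankOneOp y g
  obtain ⟨x, f, hxf⟩ := h.rankOne_of_map hA
  refine ⟨x, f, ?_⟩
  rw [bilin_apply, ← hA]
  congr 1
  exact Subtype.ext hxf.symm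

/-- If the trace is multiplicative on the pairs `φ (x ⊗ f₀)`, `φ (x₀ ⊗ f)`, the space is a line. -/
theorem eq_mul_of_trace_mul (h : PreservesMulPow 𝒜 φ s) {x₀ : X₁} {f₀ : StrongDual ℂ X₁}
    (h₀ : f₀ x₀ = 1)
    (hmul : ∀ x f, ∃ a b c d, h.bilin x f₀ = rankOneOp a b ∧ h.bilin x₀ f = rankOneOp c d ∧
      b c * d a = b a * d c) (x : X₁) (f : StrongDual ℂ X₁) : f x = f x₀ * f₀ x := by
  have htr : ∀ x f a b c d, h.bilin x f₀ = rankOneOp a b → h.bilin x₀ f = rankOneOp c d →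
      b c * d a = b a * d c := by
    intro x f a b c d hab hcd
    obtain ⟨a', b', c', d', hab', hcd', heq⟩ := hmul x f
    rw [hab] at hab'
    rw [hcd] at hcd'
    rw [trace_mul_eq_of_rankOneOp_eq hab' hcd', heq, trace_eq_of_rankOneOp_eq hab',
      trace_eq_of_rankOneOp_eq hcd']
  have hgood : ∀ f : StrongDual ℂ X₁, f x₀ ≠ 0 → f x = f x₀ * f₀ x := by
    intro f hf
    obtain ⟨a, b, hab⟩ := h.bilin_rankOne x f₀
    obtain ⟨c, d, hcd⟩ := h.bilin_rankOne x₀ f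
    obtain ⟨p, q, hpq⟩ := h.bilin_rankOne x₀ f₀
    -- Let `τ` be the trace of the image. Under multiplicativity, `e1` to `e3` evaluate `τ(x, f₀)
    -- τ(x₀, f) ^ (s + 1)`, `τ(x₀, f₀) τ(x₀, f) ^ (s + 1)` and `τ(x, f₀) τ(x₀, f₀) ^ (s + 1)`. As
    -- `τ(x₀, f₀) ^ (s + 2) = 1`, the first is the product of the other two.
    have e1 := h.apply_mul_pow rfl hcd ⟨_, h.rankOneOp_mem x f₀⟩
    have e2 := h.apply_mul_pow rfl hcd ⟨_, h.rankOneOp_mem x₀ f₀⟩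
    have e3 := h.apply_mul_pow rfl hpq ⟨_, h.rankOneOp_mem x f₀⟩
    rw [← h.bilin_apply, hab] at e1 e3
    rw [← h.bilin_apply, hpq] at e2
    have e4 := h.trace_pow rfl hpq
    simp only [rankOneOp_apply, _root_.map_smul, smul_eq_mul, h₀, one_pow, one_mul, mul_one]
      at e1 e2 e3 e4
    have t1 := htr _ _ _ _ _ _ hab hcd
    have t2 := htr _ _ _ _ _ _ hpq hcd
    have t3 := htr _ _ _ _ _ _ hab hpq
    apply mul_right_cancel₀ (pow_ne_zero s hf)
    rw [t1] at e1
    rw [t2] at e2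
    rw [t3] at e3
    linear_combination -e1 + (b a * d c ^ (s + 1)) * e4 * (-1) +
      (b a * q p ^ (s + 1)) * e2 + (f x₀ ^ (s + 1)) * e3
  by_cases hf : f x₀ = 0
  · have h1 := hgood (f + f₀) (by simp [hf, h₀])
    simp only [add_apply, hf, h₀] at h1
    rw [hf]
    linear_combination h1
  · exact hgood f hf

/-- The sections through `x₀` and `f₀` each have a common range or a common kernel. The mixed cases
give the two forms. If both share a range, or both share a kernel, traces multiply, so `X₁` is a
line and the first form holds. -/
theorem bilin_eq_rankOneOp (h : PreservesMulPow 𝒜 φ s) :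
    (∃ (T : X₁ →ₗ[ℂ] X₂) (S : StrongDual ℂ X₁ →ₗ[ℂ] StrongDual ℂ X₂),
      ∀ x f, h.bilin x f = rankOneOp (T x) (S f)) ∨
    ∃ (T : StrongDual ℂ X₁ →ₗ[ℂ] X₂) (S : X₁ →ₗ[ℂ] StrongDual ℂ X₂),
      ∀ x f, h.bilin x f = rankOneOp (T f) (S x) := by
  obtain ⟨x₀, hx₀⟩ := exists_ne (0 : X₁)
  obtain ⟨f₀, h₀⟩ := SeparatingDual.exists_eq_one (R := ℂ) hx₀
  have hf₀ : f₀ ≠ 0 := by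
    rintro rfl
    simp at h₀
  have hline : (∀ (x : X₁) (f : StrongDual ℂ X₁), f x = f x₀ * f₀ x) →
      ∃ (T : X₁ →ₗ[ℂ] X₂) (S : StrongDual ℂ X₁ →ₗ[ℂ] StrongDual ℂ X₂),
      ∀ x f, h.bilin x f = rankOneOp (T x) (S f) := by
    intro hxf
    obtain ⟨y, g, hyg⟩ := h.bilin_rankOne x₀ f₀
    refine exists_eq_rankOneOp_of_bilinear h.bilin h.bilin_rankOne h.bilin_eq_zero hx₀ hf₀
      ⟨y, fun f => ⟨f x₀ • g, ?_⟩⟩ ⟨g, fun x => ⟨f₀ x • y, ?_⟩⟩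
    · have hf : f = f x₀ • f₀ := by
        ext x
        simpa using hxf x f
      conv_lhs => rw [hf]
      rw [_root_.map_smul, hyg, ← rankOneBilin_apply, ← rankOneBilin_apply, _root_.map_smul]
    · have hx : x = f₀ x • x₀ := by
        rw [← sub_eq_zero]
        refine SeparatingDual.eq_zero_of_forall_dual_eq_zero (R := ℂ) fun f => ?_
        simp only [map_sub, _root_.map_smul, smul_eq_mul]
        linear_combination hxf x f
      conv_lhs => rw [hx]
      rw [LinearMap.map_smul₂, hyg, ← rankOneBilin_apply, ← rankOneBilin_apply,
        LinearMap.map_smul₂]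
  rcases common_range_or_common_ker (h.bilin x₀) (h.bilin_rankOne x₀) with hl | hl <;>
    rcases common_range_or_common_ker (h.bilin.flip f₀) (fun x => h.bilin_rankOne x f₀) with hr | hr
  · left
    apply hline
    apply h.eq_mul_of_trace_mul h₀
    intro x f
    obtain ⟨y, hy⟩ := hl
    obtain ⟨y', hy'⟩ := hr
    obtain ⟨β, hβ⟩ := hy' x
    obtain ⟨δ, hδ⟩ := hy f
    refine ⟨y', β, y, δ, hβ, hδ, ?_⟩
    obtain ⟨g, hg⟩ := hy f₀
    obtain ⟨g', hg'⟩ := hy' x₀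
    have hyy : ∀ z, g z • y = g' z • y' := fun z => congr($(hg.symm.trans hg') z)
    obtain ⟨z, hz⟩ : ∃ z, g' z • y' ≠ 0 := by
      by_contra! h0
      exact (h.bilin_eq_zero x₀ f₀ (hg'.trans (ContinuousLinearMap.ext h0))).elim hx₀ hf₀
    have hz' : g' z ≠ 0 := fun h0 => hz (by rw [h0, zero_smul])
    have h1 := congr(β $(hyy z))
    have h2 := congr(δ $(hyy z))
    simp only [_root_.map_smul, smul_eq_mul] at h1 h2
    apply mul_left_cancel₀ hz'
    linear_combination (δ y) * h1 - (β y) * h2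
  · exact Or.inl (exists_eq_rankOneOp_of_bilinear h.bilin h.bilin_rankOne h.bilin_eq_zero hx₀ hf₀
      hl hr)
  · right
    obtain ⟨T, S, hTS⟩ := exists_eq_rankOneOp_of_bilinear h.bilin.flip
      (fun f x => h.bilin_rankOne x f) (fun f x h0 => (h.bilin_eq_zero x f h0).symm) hf₀ hx₀ hr hl
    exact ⟨T, S, fun x f => hTS f x⟩
  · left
    apply hline
    apply h.eq_mul_of_trace_mul h₀
    intro x f
    obtain ⟨g, hg⟩ := hl
    obtain ⟨g', hg'⟩ := hr
    obtain ⟨β, hβ⟩ := hg' x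
    obtain ⟨δ, hδ⟩ := hg f
    refine ⟨β, g', δ, g, hβ, hδ, ?_⟩
    obtain ⟨y, hy⟩ := hg f₀
    obtain ⟨y', hy'⟩ := hg' x₀
    have hgg : ∀ z, g z • y = g' z • y' := fun z => congr($(hy.symm.trans hy') z)
    have hy0 : y' ≠ 0 := by
      rintro rfl
      rw [rankOneOp_zero_left] at hy'
      exact (h.bilin_eq_zero x₀ f₀ hy').elim hx₀ hf₀
    obtain ⟨k, hk⟩ := SeparatingDual.exists_eq_one (R := ℂ) hy0
    have h1 := congr(k $(hgg δ))
    have h2 := congr(k $(hgg β))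
    simp only [_root_.map_smul, smul_eq_mul, hk, mul_one] at h1 h2
    rw [← h1, ← h2]
    ring

theorem surjective_of_bilin_eq (h : PreservesMulPow 𝒜 φ s) {U V : Type*} [AddCommGroup U]
    [Module ℂ U] [AddCommGroup V] [Module ℂ V] (T : U →ₗ[ℂ] X₂) (S : V →ₗ[ℂ] StrongDual ℂ X₂)
    (hTS : ∀ x f, ∃ u v, h.bilin x f = rankOneOp (T u) (S v)) :
    Function.Surjective T ∧ Function.Surjective S := by
  have key : ∀ y g, ∃ u v, rankOneOp (T u) (S v) = rankOneOp y g := by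
    intro y g
    obtain ⟨x, f, hxf⟩ := h.exists_bilin_eq y g
    obtain ⟨u, v, huv⟩ := hTS x f
    exact ⟨u, v, huv.symm.trans hxf⟩
  obtain ⟨y₀, hy₀⟩ := exists_ne (0 : X₂)
  obtain ⟨g₀, hg₀⟩ := SeparatingDual.exists_eq_one (R := ℂ) hy₀
  constructor
  · intro y
    obtain ⟨u, v, huv⟩ := key y g₀
    refine ⟨S v y₀ • u, ?_⟩
    have h1 := congr($huv y₀)
    simpa [hg₀] using h1
  · intro g
    obtain ⟨u, v, huv⟩ := key y₀ g
    refine ⟨g₀ (T u) • v, ?_⟩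
    ext z
    have h1 := congr(g₀ ($huv z))
    simp only [rankOneOp_apply, _root_.map_smul, smul_eq_mul, hg₀, mul_one] at h1
    simp only [_root_.map_smul, smul_apply, smul_eq_mul]
    linear_combination h1

theorem iso_or_antiIso (h : PreservesMulPow 𝒜 φ s) :
    (∃ (l : ℂ) (T : X₁ ≃L[ℂ] X₂), l ^ (s + 2) = 1 ∧ ∀ A : 𝒜,
      φ A = l • ((T : X₁ →L[ℂ] X₂) ∘L (A : X₁ →L[ℂ] X₁) ∘L (T.symm : X₂ →L[ℂ] X₁))) ∨
    ∃ (l : ℂ) (T : StrongDual ℂ X₁ ≃L[ℂ] X₂), l ^ (s + 2) = 1 ∧ ∀ A : 𝒜,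
      φ A = l • ((T : StrongDual ℂ X₁ →L[ℂ] X₂) ∘L banachAdjoint (A : X₁ →L[ℂ] X₁) ∘L
        (T.symm : X₂ →L[ℂ] StrongDual ℂ X₁)) := by
  obtain ⟨x₀, hx₀⟩ := exists_ne (0 : X₁)
  obtain ⟨f₀, h₀⟩ := SeparatingDual.exists_eq_one (R := ℂ) hx₀
  rcases h.bilin_eq_rankOneOp with ⟨T, S, hTS⟩ | ⟨T, S, hTS⟩
  · left
    obtain ⟨hT, hS⟩ := h.surjective_of_bilin_eq T S fun x f => ⟨x, f, hTS x f⟩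
    let b : X₁ →ₗ[ℂ] StrongDual ℂ X₁ →ₗ[ℂ] ℂ := LinearMap.mk₂ ℂ (fun x f => f x)
      (by simp) (by simp) (by simp) (by simp)
    refine exists_equiv_of_pairing b (fun f => f.continuous) ⟨x₀, f₀, by simp [b, h₀]⟩
      (fun x hx hbx => hx ?_) T S hT hS s (fun x f => h.trace_pow rfl (hTS x f)) φ
      (fun A : 𝒜 => (A : X₁ →L[ℂ] X₁)) (fun A x f => h.apply_mul_pow rfl (hTS x f) A)
    exact SeparatingDual.eq_zero_of_forall_dual_eq_zero (R := ℂ) fun f => congr($hbx f)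
  · right
    obtain ⟨hT, hS⟩ := h.surjective_of_bilin_eq T S fun x f => ⟨f, x, hTS x f⟩
    let b : StrongDual ℂ X₁ →ₗ[ℂ] X₁ →ₗ[ℂ] ℂ := LinearMap.mk₂ ℂ (fun f x => f x)
      (by simp) (by simp) (by simp) (by simp)
    refine exists_equiv_of_pairing b (fun x => ?_) ⟨f₀, x₀, by simp [b, h₀]⟩
      (fun f hf hbf => hf ?_) T S hT hS s (fun f x => h.trace_pow rfl (hTS x f)) φ
      (fun A : 𝒜 => banachAdjoint (A : X₁ →L[ℂ] X₁))
      (fun A f x => h.apply_mul_pow rfl (hTS x f) A)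
    · exact (ContinuousLinearMap.apply ℂ ℂ x).continuous
    · exact ContinuousLinearMap.ext fun x => congr($hbf x)

end PreservesMulPow

end Preserver

/-! ### Banach space adjoints and reflexivity. -/

section Adjoint

variable {X : Type*} [NormedAddCommGroup X] [NormedSpace ℂ X]

@[simp] theorem banachAdjoint_apply (A : X →L[ℂ] X) (f : StrongDual ℂ X) (x : X) :
    banachAdjoint A f x = f (A x) := rfl

theorem banachAdjoint_one : banachAdjoint (1 : X →L[ℂ] X) = 1 := rfl

theorem banachAdjoint_mul (A B : X →L[ℂ] X) :
    banachAdjoint (A * B) = banachAdjoint B * banachAdjoint A := rfl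

theorem banachAdjoint_injective :
    Function.Injective (banachAdjoint : (X →L[ℂ] X) → (StrongDual ℂ X →L[ℂ] StrongDual ℂ X)) := by
  intro A B h
  ext x
  rw [← sub_eq_zero]
  refine SeparatingDual.eq_zero_of_forall_dual_eq_zero (R := ℂ) fun f => ?_
  rw [map_sub, sub_eq_zero]
  exact congr($h f x)

/-- The adjoint of `D` acts on the bidual; carried back to `X` by the canonical isometry, it is a
pre-adjoint of `D`. -/
theorem IsReflexiveSpace.banachAdjoint_surjective (hX : IsReflexiveSpace X) :
    Function.Surjective
      (banachAdjoint : (X →L[ℂ] X) → (StrongDual ℂ X →L[ℂ] StrongDual ℂ X)) := by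
  intro D
  let J : X ≃ₗᵢ[ℂ] StrongDual ℂ (StrongDual ℂ X) :=
    LinearIsometryEquiv.ofSurjective (NormedSpace.inclusionInDoubleDualLi ℂ) hX
  let E : X →L[ℂ] X := (J.symm.toContinuousLinearEquiv : StrongDual ℂ (StrongDual ℂ X) →L[ℂ] X) ∘L
    banachAdjoint D ∘L NormedSpace.inclusionInDoubleDual ℂ X
  have hE : ∀ x, J (E x) = banachAdjoint D (NormedSpace.inclusionInDoubleDual ℂ X x) :=
    fun x => J.apply_symm_apply _
  refine ⟨E, ?_⟩
  ext f x
  exact congr($(hE x) f)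

/-- The inverse of an adjoint is again an adjoint, so invertibility passes both ways. -/
theorem IsReflexiveSpace.spectrum_banachAdjoint (hX : IsReflexiveSpace X) (A : X →L[ℂ] X) :
    spectrum ℂ (banachAdjoint A) = spectrum ℂ A := by
  have hunit : ∀ B : X →L[ℂ] X, IsUnit (banachAdjoint B) ↔ IsUnit B := by
    intro B
    rw [isUnit_iff_exists, isUnit_iff_exists]
    constructor
    · rintro ⟨D, h1, h2⟩
      obtain ⟨C, rfl⟩ := hX.banachAdjoint_surjective D
      exact ⟨C, banachAdjoint_injective h2, banachAdjoint_injective h1⟩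
    · rintro ⟨C, h1, h2⟩
      exact ⟨banachAdjoint C, by rw [← banachAdjoint_mul, h2, banachAdjoint_one],
        by rw [← banachAdjoint_mul, h1, banachAdjoint_one]⟩
  ext z
  rw [spectrum.mem_iff, spectrum.mem_iff, not_iff_not, ← hunit]
  congr! 1
  ext f x
  simp [Algebra.algebraMap_eq_smul_one]

theorem map_list_prod_of_antimultiplicative {R R' : Type*} [Monoid R] [Monoid R'] {F : R → R'}
    (h1 : F 1 = 1) (hmul : ∀ a b, F (a * b) = F b * F a) (L : List R) :
    F L.prod = (L.reverse.map F).prod := by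
  induction L with
  | nil => simpa using h1
  | cons a L ih => simp [hmul, ih]

set_option synthInstance.maxHeartbeats 200000 in
theorem banachAdjoint_list_prod (L : List (X →L[ℂ] X)) :
    banachAdjoint L.prod = (L.reverse.map banachAdjoint).prod :=
  map_list_prod_of_antimultiplicative banachAdjoint_one banachAdjoint_mul L

theorem IsReflexiveSpace.dual (hX : IsReflexiveSpace X) : IsReflexiveSpace (StrongDual ℂ X) := by
  intro Λ
  refine ⟨Λ ∘L NormedSpace.inclusionInDoubleDual ℂ X, ?_⟩
  ext ψ
  obtain ⟨x, rfl⟩ := hX ψ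
  rfl

theorem IsReflexiveSpace.of_equiv {Y : Type*} [NormedAddCommGroup Y] [NormedSpace ℂ Y]
    (hX : IsReflexiveSpace X) (E : X ≃L[ℂ] Y) : IsReflexiveSpace Y := by
  intro Λ
  obtain ⟨x, hx⟩ := hX (Λ ∘L ContinuousLinearMap.precomp ℂ (E.symm : Y →L[ℂ] X))
  refine ⟨E x, ?_⟩
  ext g
  have h := congr($hx (g ∘L (E : X →L[ℂ] Y)))
  have h2 : (g ∘L (E : X →L[ℂ] Y)) ∘L (E.symm : Y →L[ℂ] X) = g := by
    ext y
    simp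
  change g (E x) = Λ ((g ∘L (E : X →L[ℂ] Y)) ∘L (E.symm : Y →L[ℂ] X)) at h
  rw [h2] at h
  exact h

/-- If every rank one operator on the dual is an adjoint, then the space is reflexive. -/
theorem isReflexiveSpace_of_rankOneOp_eq_banachAdjoint
    (h : ∀ (f : StrongDual ℂ X) (ψ : StrongDual ℂ (StrongDual ℂ X)),
      ∃ A : X →L[ℂ] X, banachAdjoint A = rankOneOp f ψ) : IsReflexiveSpace X := by
  rcases subsingleton_or_nontrivial X with hX | hX
  · intro ψ
    refine ⟨0, ?_⟩
    ext f
    have hf : f = 0 := ContinuousLinearMap.ext fun x => by simp [Subsingleton.elim x 0]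
    simp [hf]
  obtain ⟨x₀, hx₀⟩ := exists_ne (0 : X)
  obtain ⟨f₀, h₀⟩ := SeparatingDual.exists_eq_one (R := ℂ) hx₀
  intro ψ
  obtain ⟨A, hA⟩ := h f₀ ψ
  refine ⟨A x₀, ?_⟩
  ext g
  have h1 := congr($hA g x₀)
  simpa [h₀] using h1

end Adjoint

/-! ### Cyclic words, and separating them by operators. -/

section Words

variable {X : Type*} [NormedAddCommGroup X] [NormedSpace ℂ X]

/-- The index sequence read cyclically from just after `p` to just before `p`. -/
def cyclicWord {k m : ℕ} (i : Fin m → Fin k) (p : Fin m) : List (Fin k) :=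
  (List.ofFn i).drop ((p : ℕ) + 1) ++ (List.ofFn i).take (p : ℕ)

theorem isQuasiSemiJordan_iff {k m : ℕ} {i : Fin m → Fin k} {p : Fin m} :
    IsQuasiSemiJordan i p ↔ cyclicWord i p = (cyclicWord i p).reverse := by
  rw [cyclicWord, List.reverse_append]
  rfl

theorem length_cyclicWord_add_one {k m : ℕ} (i : Fin m → Fin k) (p : Fin m) :
    (cyclicWord i p).length + 1 = m := by
  have := p.isLt
  simp [cyclicWord]
  omega

theorem not_mem_cyclicWord {k m : ℕ} {i : Fin m → Fin k} {p : Fin m}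
    (hi : IsGeneralizedProductIndex i p) : i p ∉ cyclicWord i p := by
  intro h
  rw [cyclicWord, List.mem_append, List.mem_iff_getElem, List.mem_iff_getElem] at h
  rcases h with ⟨n, hn, h⟩ | ⟨n, hn, h⟩
  · simp only [List.length_drop, List.length_ofFn] at hn
    rw [List.getElem_drop, List.getElem_ofFn] at h
    refine hi.unique _ ?_ h
    rw [Ne, Fin.ext_iff]
    simp only
    omega
  · simp only [List.length_take, List.length_ofFn] at hn
    rw [List.getElem_take, List.getElem_ofFn] at h
    refine hi.unique _ ?_ h
    rw [Ne, Fin.ext_iff]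
    simp only
    omega

theorem generalizedProduct_eq {k m : ℕ} (i : Fin m → Fin k) (p : Fin m)
    (T : Fin k → (X →L[ℂ] X)) :
    generalizedProduct i T = (((List.ofFn i).take (p : ℕ)).map T).prod *
      (T (i p) * (((List.ofFn i).drop ((p : ℕ) + 1)).map T).prod) := by
  have h1 : (List.ofFn fun j => T (i j)) = (List.ofFn i).map T := by
    rw [List.map_ofFn]
    rfl
  have h2 : List.ofFn i =
      (List.ofFn i).take (p : ℕ) ++ i p :: (List.ofFn i).drop ((p : ℕ) + 1) := by
    conv_lhs => rw [← List.take_append_drop (p : ℕ) (List.ofFn i)]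
    congr 1
    rw [List.drop_eq_getElem_cons (by simp)]
    simp
  rw [generalizedProduct, h1]
  conv_lhs => rw [h2]
  rw [List.map_append, List.prod_append, List.map_cons, List.prod_cons]

/-- Cyclic commutation carries the prefix before `p` to the far right. -/
theorem peripheralSpectrum_generalizedProduct [CompleteSpace X] {k m : ℕ} (i : Fin m → Fin k)
    (p : Fin m) (T : Fin k → (X →L[ℂ] X)) :
    peripheralSpectrum (generalizedProduct i T) =
      peripheralSpectrum (T (i p) * ((cyclicWord i p).map T).prod) := by
  rw [generalizedProduct_eq i p, peripheralSpectrum_mul_comm, cyclicWord, List.map_append,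
    List.prod_append, mul_assoc]

/-- With the operator at the distinguished index replaced by `A`. -/
theorem peripheralSpectrum_generalizedProduct_update [CompleteSpace X] {k m : ℕ}
    {i : Fin m → Fin k} {p : Fin m} (hi : IsGeneralizedProductIndex i p)
    (T : Fin k → (X →L[ℂ] X)) (A : X →L[ℂ] X) :
    peripheralSpectrum (generalizedProduct i (Function.update T (i p) A)) =
      peripheralSpectrum (A * ((cyclicWord i p).map T).prod) := by
  rw [peripheralSpectrum_generalizedProduct i p, Function.update_self]
  congr 3
  refine List.map_congr_left fun j hj => ?_
  rw [Function.update_of_ne]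
  rintro rfl
  exact not_mem_cyclicWord hi hj

theorem list_prod_map_smul {ι R : Type*} [Ring R] [Algebra ℂ R] (l : ℂ) (F : ι → R)
    (w : List ι) : (w.map fun j => l • F j).prod = l ^ w.length • (w.map F).prod := by
  induction w with
  | nil => simp
  | cons j w ih =>
    simp only [List.map_cons, List.prod_cons, ih, List.length_cons, smul_mul_smul_comm, pow_succ']

theorem exists_dual_pair (h : 2 ≤ Module.rank ℂ X) : ∃ (e₁ e₂ : X) (f₁ f₂ : StrongDual ℂ X),
    f₁ e₁ = 1 ∧ f₁ e₂ = 0 ∧ f₂ e₁ = 0 ∧ f₂ e₂ = 1 := by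
  have h1 : ∀ x f, (1 : X →L[ℂ] X) ≠ rankOneOp x f := by
    intro x f h1
    have h2 : Module.rank ℂ X ≤ 1 := by
      rw [rank_le_one_iff]
      exact ⟨x, fun v => ⟨f v, congr($h1.symm v)⟩⟩
    exact absurd (h.trans h2) (by norm_num)
  obtain ⟨e₁, e₂, f₁, f₂, h11, h12, h21, h22, -⟩ := exists_compression_det_ne_zero h1
  exact ⟨e₁, e₂, f₁, f₂, h11, h12, h21, h22⟩

/-- Words of equal length in an alphabet are separated by `2 × 2` triangular matrices. -/
theorem eq_of_forall_list_prod_map_eq (h : 2 ≤ Module.rank ℂ X) {k : ℕ} (hk : 2 ≤ k)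
    {w w' : List (Fin k)} (hlen : w.length = w'.length)
    (hprod : ∀ (x x' : Fin k → X) (f f' : Fin k → StrongDual ℂ X),
      (w.map fun j => rankOneOp (x j) (f j) + rankOneOp (x' j) (f' j)).prod =
        (w'.map fun j => rankOneOp (x j) (f j) + rankOneOp (x' j) (f' j)).prod) : w = w' := by
  obtain ⟨e₁, e₂, f₁, f₂, h11, h12, h21, h22⟩ := exists_dual_pair h
  -- In the basis `e₁, e₂` this is the matrix with rows `(k, j)` and `(0, 1)`. A product of such
  -- matrices sends `e₂` to `N • e₁ + e₂`, where `N` is the number whose base `k` digits are the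
  -- letters. Words of equal length are determined by `N`.
  let M : Fin k → (X →L[ℂ] X) := fun j =>
    rankOneOp ((k : ℂ) • e₁) f₁ + rankOneOp (((j : ℕ) : ℂ) • e₁ + e₂) f₂
  have hM : ∀ w : List (Fin k), (w.map M).prod e₂ =
      ((Nat.ofDigits k (w.map Fin.val) : ℕ) : ℂ) • e₁ + e₂ := by
    intro w
    induction w with
    | nil => simp
    | cons j w ih =>
      rw [List.map_cons, List.prod_cons, mul_apply_eq_comp, ih]
      simp only [M, add_apply, rankOneOp_apply, map_add, map_smul, h11, h12, h21, h22,
        List.map_cons, Nat.ofDigits_cons]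
      push_cast
      module
  have h1 := congr(f₁ ($(hprod (fun _ => (k : ℂ) • e₁) (fun j => ((j : ℕ) : ℂ) • e₁ + e₂)
    (fun _ => f₁) (fun _ => f₂)) e₂))
  change f₁ ((w.map M).prod e₂) = f₁ ((w'.map M).prod e₂) at h1
  rw [hM, hM] at h1
  simp only [map_add, map_smul, h11, h12, smul_eq_mul, mul_one, add_zero] at h1
  have h2 : Nat.ofDigits k (w.map Fin.val) = Nat.ofDigits k (w'.map Fin.val) := by
    exact_mod_cast h1
  have h3 := Nat.ofDigits_inj_of_len_eq (by omega) (by simpa using hlen) (by simp) (by simp) h2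
  exact List.map_injective_iff.2 Fin.val_injective h3

end Words

/-! ### The two forms, the quasi-semi Jordan condition and the classification. -/

section Main

variable {X₁ X₂ : Type*} [NormedAddCommGroup X₁] [NormedSpace ℂ X₁]
  [NormedAddCommGroup X₂] [NormedSpace ℂ X₂]

theorem peripheralSpectrum_generalizedProduct_conj {k m : ℕ} (i : Fin m → Fin k)
    {l : ℂ} (hl : l ^ m = 1) (T : X₁ ≃L[ℂ] X₂) (C : Fin k → (X₁ →L[ℂ] X₁)) :
    peripheralSpectrum (generalizedProduct i fun j =>
      l • ((T : X₁ →L[ℂ] X₂) ∘L C j ∘L (T.symm : X₂ →L[ℂ] X₁))) =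
    peripheralSpectrum (generalizedProduct i C) := by
  let e : (X₁ →L[ℂ] X₁) ≃ₐ[ℂ] (X₂ →L[ℂ] X₂) := T.conjContinuousAlgEquiv.toAlgEquiv
  have h : (generalizedProduct i fun j =>
      l • ((T : X₁ →L[ℂ] X₂) ∘L C j ∘L (T.symm : X₂ →L[ℂ] X₁))) = e (generalizedProduct i C) := by
    have h1 : (List.ofFn fun j => C (i j)) = (List.ofFn i).map C := by
      rw [List.map_ofFn]
      rfl
    have h2 : (List.ofFn fun j => l • ((T : X₁ →L[ℂ] X₂) ∘L C (i j) ∘L (T.symm : X₂ →L[ℂ] X₁))) =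
        (List.ofFn i).map fun j => l • e (C j) := by
      rw [List.map_ofFn]
      rfl
    rw [generalizedProduct, generalizedProduct, h1, h2, list_prod_map_smul, List.length_ofFn, hl,
      one_smul, map_list_prod, List.map_map]
    rfl
  rw [h]
  exact peripheralSpectrum_congr (AlgEquiv.spectrum_eq e _)

/-- Taking adjoints reverses products, so the cyclic word comes out reversed while the distinguished
factor stays in place. -/
theorem peripheralSpectrum_generalizedProduct_adjoint [CompleteSpace X₁]
    (hX : IsReflexiveSpace X₁) {k m : ℕ} (i : Fin m → Fin k) (p : Fin m)
    (C : Fin k → (X₁ →L[ℂ] X₁)) :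
    peripheralSpectrum (generalizedProduct i fun j => banachAdjoint (C j)) =
      peripheralSpectrum (C (i p) * ((cyclicWord i p).reverse.map C).prod) := by
  have h : banachAdjoint (((cyclicWord i p).reverse.map C).prod * C (i p)) =
      banachAdjoint (C (i p)) * ((cyclicWord i p).map fun j => banachAdjoint (C j)).prod := by
    rw [banachAdjoint_mul, banachAdjoint_list_prod, ← List.map_reverse, List.reverse_reverse,
      List.map_map]
    rfl
  rw [peripheralSpectrum_generalizedProduct i p, ← h,
    peripheralSpectrum_congr (hX.spectrum_banachAdjoint _), peripheralSpectrum_mul_comm]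

variable {𝒜₁ : NonUnitalSubalgebra ℂ (X₁ →L[ℂ] X₁)} {𝒜₂ : NonUnitalSubalgebra ℂ (X₂ →L[ℂ] X₂)}

theorem IsIsomorphismForm.preserves {k m : ℕ} (i : Fin m → Fin k) {Φ : 𝒜₁ → 𝒜₂}
    (h : IsIsomorphismForm m Φ) : PreservesPeripheralSpectrum i Φ := by
  obtain ⟨l, T, hl, hT⟩ := h
  intro A
  simp only [hT]
  exact peripheralSpectrum_generalizedProduct_conj i hl T _

theorem IsAntiIsomorphismForm.peripheralSpectrum_eq [CompleteSpace X₁] {k m : ℕ}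
    (i : Fin m → Fin k) (p : Fin m) {Φ : 𝒜₁ → 𝒜₂} (h : IsAntiIsomorphismForm m Φ)
    (hX : IsReflexiveSpace X₁) (A : Fin k → 𝒜₁) :
    peripheralSpectrum (generalizedProduct i fun j => (Φ (A j) : X₂ →L[ℂ] X₂)) =
      peripheralSpectrum ((A (i p) : X₁ →L[ℂ] X₁) *
        ((cyclicWord i p).reverse.map fun j => (A j : X₁ →L[ℂ] X₁)).prod) := by
  obtain ⟨l, T, hl, hT⟩ := h
  simp only [hT]
  rw [peripheralSpectrum_generalizedProduct_conj i hl T]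
  exact peripheralSpectrum_generalizedProduct_adjoint hX i p _

theorem rank_rankOneOp_le (x : X₁) (f : StrongDual ℂ X₁) :
    LinearMap.rank (rankOneOp x f : X₁ →ₗ[ℂ] X₁) ≤ 1 := by
  have h : LinearMap.range (rankOneOp x f : X₁ →ₗ[ℂ] X₁) ≤ Submodule.span ℂ {x} := by
    rintro _ ⟨z, rfl⟩
    exact Submodule.mem_span_singleton.2 ⟨f z, rfl⟩
  exact (Submodule.rank_mono h).trans ((rank_span_le _).trans (by simp))

theorem rank_rankOneOp_add_le (x x' : X₁) (f f' : StrongDual ℂ X₁) :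
    LinearMap.rank ((rankOneOp x f + rankOneOp x' f' : X₁ →L[ℂ] X₁) : X₁ →ₗ[ℂ] X₁) ≤ 2 := by
  rw [ContinuousLinearMap.toLinearMap_add]
  refine (LinearMap.rank_add_le _ _).trans ?_
  refine (add_le_add (rank_rankOneOp_le x f) (rank_rankOneOp_le x' f')).trans ?_
  norm_num

theorem IsStandardOperatorAlgebra.mem (h : IsStandardOperatorAlgebra 𝒜₁) (x x' : X₁)
    (f f' : StrongDual ℂ X₁) : rankOneOp x f + rankOneOp x' f' ∈ 𝒜₁ := by
  apply h
  rw [FiniteDimensional, ← Module.rank_lt_aleph0_iff]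
  exact (rank_rankOneOp_add_le x x' f f').trans_lt (Cardinal.natCast_lt_aleph0 (n := 2))

/-- A preimage of the conjugate of `f ⊗ ψ` by `T` exhibits `f ⊗ ψ` as an adjoint, which makes `X₁`
reflexive; `X₂` is isomorphic to its dual. -/
theorem IsAntiIsomorphismForm.isReflexiveSpace {m : ℕ} {Φ : 𝒜₁ → 𝒜₂}
    (hΦ : ∀ F : X₂ →L[ℂ] X₂, LinearMap.rank (F : X₂ →ₗ[ℂ] X₂) ≤ 2 →
      ∃ A : 𝒜₁, (Φ A : X₂ →L[ℂ] X₂) = F)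
    (h : IsAntiIsomorphismForm m Φ) : IsReflexiveSpace X₁ ∧ IsReflexiveSpace X₂ := by
  obtain ⟨l, T, hl, hT⟩ := h
  have h1 : IsReflexiveSpace X₁ := by
    refine isReflexiveSpace_of_rankOneOp_eq_banachAdjoint fun f ψ => ?_
    obtain ⟨A, hA⟩ := hΦ (rankOneOp (T f) (ψ ∘L (T.symm : X₂ →L[ℂ] StrongDual ℂ X₁)))
      ((rank_rankOneOp_le _ _).trans one_le_two)
    refine ⟨l • (A : X₁ →L[ℂ] X₁), ?_⟩
    ext g x
    apply_fun fun F => T.symm (F (T g)) x at hA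
    rw [hT] at hA
    simpa using hA
  exact ⟨h1, h1.dual.of_equiv T⟩

theorem PreservesPeripheralSpectrum.isQuasiSemiJordan [CompleteSpace X₁] [CompleteSpace X₂]
    (h𝒜₁ : IsStandardOperatorAlgebra 𝒜₁) {k m : ℕ} (hk : 2 ≤ k) {i : Fin m → Fin k} {p : Fin m}
    (hi : IsGeneralizedProductIndex i p) {Φ : 𝒜₁ → 𝒜₂} (hX : IsReflexiveSpace X₁)
    (hrank : 2 ≤ Module.rank ℂ X₁) (h : PreservesPeripheralSpectrum i Φ)
    (hanti : IsAntiIsomorphismForm m Φ) : IsQuasiSemiJordan i p := by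
  rw [isQuasiSemiJordan_iff]
  refine eq_of_forall_list_prod_map_eq hrank hk (by simp) fun x x' f f' => ?_
  -- With `y ⊗ g` at the distinguished index, the two peripheral spectra are single points: the `(y,
  -- g)` coefficients of the word and of its reversal.
  refine eq_of_forall_dual_apply_eq fun y g hg => ?_
  have hnt : Nontrivial X₁ := by
    refine ⟨y, 0, ?_⟩
    rintro rfl
    simp at hg
  let C : Fin k → 𝒜₁ := fun j => ⟨_, h𝒜₁.mem (x j) (x' j) (f j) (f' j)⟩
  let R : 𝒜₁ := ⟨rankOneOp y g, by simpa using h𝒜₁.mem y 0 g 0⟩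
  let A : Fin k → 𝒜₁ := Function.update C (i p) R
  have hA : (fun j => (A j : X₁ →L[ℂ] X₁)) =
      Function.update (fun j => (C j : X₁ →L[ℂ] X₁)) (i p) (rankOneOp y g) := by
    funext j
    exact Function.apply_update (fun _ (D : 𝒜₁) => (D : X₁ →L[ℂ] X₁)) C (i p) R j
  have h1 := h A
  rw [hanti.peripheralSpectrum_eq i p hX, hA, peripheralSpectrum_generalizedProduct_update hi,
    peripheralSpectrum_rankOneOp_mul] at h1
  have h2 : ((cyclicWord i p).reverse.map (Function.update (fun j => (C j : X₁ →L[ℂ] X₁)) (i p)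
      (rankOneOp y g))) = (cyclicWord i p).reverse.map fun j => (C j : X₁ →L[ℂ] X₁) := by
    refine List.map_congr_left fun j hj => ?_
    rw [Function.update_of_ne]
    rintro rfl
    exact not_mem_cyclicWord hi (List.mem_reverse.1 hj)
  have h3 : (A (i p) : X₁ →L[ℂ] X₁) = rankOneOp y g := by simp [A, R]
  rw [h2, h3, peripheralSpectrum_rankOneOp_mul, Set.singleton_eq_singleton_iff] at h1
  exact h1.symm

/-- In dimension at most one every operator is a scalar, equal to its adjoint under any
identification of the space with its dual. -/
theorem IsAntiIsomorphismForm.isIsomorphismForm {m : ℕ} {Φ : 𝒜₁ → 𝒜₂}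
    (hrank : Module.rank ℂ X₁ ≤ 1) (h : IsAntiIsomorphismForm m Φ) : IsIsomorphismForm m Φ := by
  obtain ⟨l, T, hl, hT⟩ := h
  have hfin : FiniteDimensional ℂ X₁ := by
    rw [FiniteDimensional, ← Module.rank_lt_aleph0_iff]
    exact hrank.trans_lt Cardinal.one_lt_aleph0
  let D : Module.Dual ℂ X₁ ≃ₗ[ℂ] StrongDual ℂ X₁ := LinearMap.toContinuousLinearMap
  have hfin' : FiniteDimensional ℂ (StrongDual ℂ X₁) := D.finiteDimensional
  let E : X₁ ≃L[ℂ] StrongDual ℂ X₁ := ContinuousLinearEquiv.ofFinrankEq (by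
    rw [← D.finrank_eq, Subspace.dual_finrank_eq])
  obtain ⟨v₀, hv₀⟩ := rank_le_one_iff.1 hrank
  refine ⟨l, E.trans T, hl, fun A => ?_⟩
  obtain ⟨a, ha⟩ := hv₀ ((A : X₁ →L[ℂ] X₁) v₀)
  have hA : ∀ x, (A : X₁ →L[ℂ] X₁) x = a • x := by
    intro x
    obtain ⟨r, rfl⟩ := hv₀ x
    rw [map_smul, ← ha, smul_comm]
  have hA' : ∀ f, banachAdjoint (A : X₁ →L[ℂ] X₁) f = a • f := by
    intro f
    ext x
    simp [hA]
  rw [hT]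
  ext y
  simp [hA, hA']

theorem PreservesPeripheralSpectrum.preservesMulPow [CompleteSpace X₁] [CompleteSpace X₂]
    (h𝒜₁ : IsStandardOperatorAlgebra 𝒜₁) {k s : ℕ} {i : Fin (s + 2) → Fin k} {p : Fin (s + 2)}
    (hi : IsGeneralizedProductIndex i p) {Φ : 𝒜₁ → 𝒜₂}
    (hΦ : ∀ F : X₂ →L[ℂ] X₂, LinearMap.rank (F : X₂ →ₗ[ℂ] X₂) ≤ 2 →
      ∃ A : 𝒜₁, (Φ A : X₂ →L[ℂ] X₂) = F)
    (h : PreservesPeripheralSpectrum i Φ) :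
    PreservesMulPow 𝒜₁ (fun A => (Φ A : X₂ →L[ℂ] X₂)) s where
  mem x f x' f' := h𝒜₁.mem x x' f f'
  range y g y' g' := hΦ _ (rank_rankOneOp_add_le y y' g g')
  peripheralSpectrum_eq A B := by
    have h1 := h (Function.update (fun _ => B) (i p) A)
    have hlen : (cyclicWord i p).length = s + 1 :=
      Nat.succ_injective (length_cyclicWord_add_one i p)
    have e1 : (fun j => (Φ (Function.update (fun _ => B) (i p) A j) : X₂ →L[ℂ] X₂)) =
        Function.update (fun _ => (Φ B : X₂ →L[ℂ] X₂)) (i p) (Φ A : X₂ →L[ℂ] X₂) := by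
      funext j
      exact Function.apply_update (fun _ (D : 𝒜₁) => (Φ D : X₂ →L[ℂ] X₂)) (fun _ => B) (i p) A j
    have e2 : (fun j => (Function.update (fun _ => B) (i p) A j : X₁ →L[ℂ] X₁)) =
        Function.update (fun _ => (B : X₁ →L[ℂ] X₁)) (i p) (A : X₁ →L[ℂ] X₁) := by
      funext j
      exact Function.apply_update (fun _ (D : 𝒜₁) => (D : X₁ →L[ℂ] X₁)) (fun _ => B) (i p) A j
    rw [e1, e2, peripheralSpectrum_generalizedProduct_update hi,
      peripheralSpectrum_generalizedProduct_update hi, List.map_const', List.map_const',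
      List.prod_replicate, List.prod_replicate, hlen] at h1
    exact h1

theorem PreservesPeripheralSpectrum.iso_or_antiIso [CompleteSpace X₁] [CompleteSpace X₂]
    (h𝒜₁ : IsStandardOperatorAlgebra 𝒜₁) {k m : ℕ} (hk : 2 ≤ k) {i : Fin m → Fin k} {p : Fin m}
    (hi : IsGeneralizedProductIndex i p) {Φ : 𝒜₁ → 𝒜₂}
    (hΦ : ∀ F : X₂ →L[ℂ] X₂, LinearMap.rank (F : X₂ →ₗ[ℂ] X₂) ≤ 2 →
      ∃ A : 𝒜₁, (Φ A : X₂ →L[ℂ] X₂) = F)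
    (h : PreservesPeripheralSpectrum i Φ) :
    IsIsomorphismForm m Φ ∨ IsAntiIsomorphismForm m Φ := by
  have hm : 2 ≤ m := by
    have := Fintype.card_le_of_surjective i hi.surjective
    simp only [Fintype.card_fin] at this
    omega
  obtain ⟨s, rfl⟩ : ∃ s, m = s + 2 := ⟨m - 2, by omega⟩
  have hpow := h.preservesMulPow h𝒜₁ hi hΦ
  -- Zero spaces are treated apart: a zero `X₁` leaves `Φ` only one value, and a zero `X₂` has empty
  -- peripheral spectra while those of rank one operators on a nonzero `X₁` are singletons.
  rcases subsingleton_or_nontrivial X₁ with hX₁ | hX₁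
  · left
    have hX₂ : Subsingleton X₂ := by
      by_contra hX₂
      rw [not_subsingleton_iff_nontrivial] at hX₂
      obtain ⟨y, hy⟩ := exists_ne (0 : X₂)
      obtain ⟨g, hg⟩ := SeparatingDual.exists_eq_one (R := ℂ) hy
      have hg0 : g ≠ 0 := by
        rintro rfl
        simp at hg
      obtain ⟨A, hA⟩ := hpow.exists_eq_rankOneOp y g
      obtain ⟨B, hB⟩ := hpow.exists_eq_rankOneOp (0 : X₂) 0
      have hAB : A = B := Subtype.ext (Subsingleton.elim _ _)
      apply rankOneOp_ne_zero hy hg0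
      rw [← hA, hAB, hB, rankOneOp_zero_left]
    refine ⟨1, ContinuousLinearEquiv.ofFinrankEq ?_, one_pow _, fun A => Subsingleton.elim _ _⟩
    rw [Module.finrank_zero_of_subsingleton, Module.finrank_zero_of_subsingleton]
  have hX₂ : Nontrivial X₂ := by
    by_contra hX₂
    rw [not_nontrivial_iff_subsingleton] at hX₂
    have h1 := hpow.peripheralSpectrum_eq ⟨_, hpow.rankOneOp_mem 0 0⟩ ⟨_, hpow.rankOneOp_mem 0 0⟩
    rw [peripheralSpectrum_of_subsingleton, peripheralSpectrum_rankOneOp_mul] at h1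
    exact Set.singleton_ne_empty _ h1.symm
  exact hpow.iso_or_antiIso

end Main

theorem theorem2p1 {X₁ X₂ : Type*}
    [NormedAddCommGroup X₁] [NormedSpace ℂ X₁] [CompleteSpace X₁]
    [NormedAddCommGroup X₂] [NormedSpace ℂ X₂] [CompleteSpace X₂]
    (𝒜₁ : NonUnitalSubalgebra ℂ (X₁ →L[ℂ] X₁)) (h𝒜₁ : IsStandardOperatorAlgebra 𝒜₁)
    (𝒜₂ : NonUnitalSubalgebra ℂ (X₂ →L[ℂ] X₂)) (h𝒜₂ : IsStandardOperatorAlgebra 𝒜₂)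
    {k m : ℕ} (hk : 2 ≤ k) (i : Fin m → Fin k) (p : Fin m)
    (hi : IsGeneralizedProductIndex i p)
    (Φ : 𝒜₁ → 𝒜₂)
    (hΦ : ∀ F : X₂ →L[ℂ] X₂, LinearMap.rank (F : X₂ →ₗ[ℂ] X₂) ≤ 2 →
      ∃ A : 𝒜₁, (Φ A : X₂ →L[ℂ] X₂) = F) :
    (PreservesPeripheralSpectrum i Φ ↔
      IsIsomorphismForm m Φ ∨
        (IsAntiIsomorphismForm m Φ ∧ IsReflexiveSpace X₁ ∧ IsReflexiveSpace X₂ ∧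
          IsQuasiSemiJordan i p)) ∧
    (IsAntiIsomorphismForm m Φ → IsReflexiveSpace X₁ ∧ IsReflexiveSpace X₂) ∧
    (2 ≤ Module.rank ℂ X₁ → PreservesPeripheralSpectrum i Φ → IsAntiIsomorphismForm m Φ →
      IsQuasiSemiJordan i p) := by
  refine ⟨⟨fun h => ?_, ?_⟩, fun hanti => hanti.isReflexiveSpace hΦ, fun hrank h hanti =>
    h.isQuasiSemiJordan h𝒜₁ hk hi (hanti.isReflexiveSpace hΦ).1 hrank hanti⟩
  · rcases h.iso_or_antiIso h𝒜₁ hk hi hΦ with hiso | hanti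
    · exact Or.inl hiso
    rcases le_or_gt 2 (Module.rank ℂ X₁) with hrank | hrank
    · obtain ⟨h1, h2⟩ := hanti.isReflexiveSpace hΦ
      exact Or.inr ⟨hanti, h1, h2, h.isQuasiSemiJordan h𝒜₁ hk hi h1 hrank hanti⟩
    -- In dimension at most one the word need not be a palindrome, so the first alternative is used.
    · left
      refine hanti.isIsomorphismForm ?_
      rwa [← not_lt, ← Cardinal.two_le_iff_one_lt, not_le]
  · rintro (hiso | ⟨hanti, h1, -, hqsj⟩)
    · exact hiso.preserves i
    · intro A
      rw [hanti.peripheralSpectrum_eq i p h1, ← isQuasiSemiJordan_iff.1 hqsj,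
        peripheralSpectrum_generalizedProduct i p]
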